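/- Let $d\ge 1$ and $n\ge 2$. For $y=(y_1,\dots,y_n)$ with $y_i=(y_i^1,\dots,y_i^d)\in\mathbb{R}^d$ let $\mathbf{D}_n$ be the full gradient in $y$, let $\mathbb{T}^{d\times n}$ be the torus of functions that are 1-periodic in each $y_i$, let $\langle\cdot\rangle$ be the average over $\mathbb{T}^{d\times n}$, and let the absolute value (resp. norm) of a tensor (resp. tensor-valued function) be the sum of the absolute values (resp. norms) of its components. Let $A(y_1,\dots,y_n)$ be a real $d\times d$ matrix that is 1-periodic in each $y_i$ and satisfies, for all $\xi\in\mathbb{R}^d$ and all $y$ (with the Euclidean norm on $\mathbb{R}^d$), $$\xi\cdot A\xi\ge\lambda|\xi|^2,\qquad |A\xi|\le\lambda^{-1}|\xi|,\qquad |\mathbf{D}_n^\ell A|\le C_0\Lambda_0^\ell\,\ell!\quad(\ell\ge 0),$$ where $\lambda,C_0,\Lambda_0>0$. Let $1\ge\varepsilon_1>\varepsilon_2>\dots>\varepsilon_n>0$, and put $\delta_i=\varepsilon_i/\varepsilon_1$, $\widehat\nabla_n=\sum_{i=1}^n\delta_i^{-1}\nabla_{y_i}$ and $\widehat\Delta_n=\widehat\nabla_n\cdot\widehat\nabla_n$.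 There are constants $\widetilde C>0$, depending only on $d,n,C_0,\Lambda_0$, and $c>0$, depending only on $d,n,\lambda,C_0,\Lambda_0$, such that for every $K\ge1$ there is a constant $C$, depending only on $d,n,\lambda,C_0,\Lambda_0$ and $K$, with the following property. If $$\varepsilon_{j+1}\le\widetilde C^{-1}\varepsilon_j\qquad\text{for } j=1,\dots,n-1,$$ and if $\tau\simeq\max_{1\le i\le n-1}e^{-c\varepsilon_i/\varepsilon_{i+1}}$ in the sense that $$K^{-1}\max_{1\le i\le n-1}e^{-c\varepsilon_i/\varepsilon_{i+1}}\le\tau\le K\max_{1\le i\le n-1}e^{-c\varepsilon_i/\varepsilon_{i+1}},$$ then there is exactly one $\mathcal X=(\mathcal X^1,\dots,\mathcal X^d)$, smooth on $\mathbb{T}^{d\times n}$, with $$-\widehat\nabla_n\cdot A\widehat\nabla_n\mathcal X^j+\tau^2\mathcal X^j=\widehat\nabla_n\cdot(Ae_j)\quad\text{in }\mathbb{T}^{d\times n},\qquad j=1,\dots,d,$$ and, with $(A\widehat\nabla_n\mathcal X)_{ij}=\sum_l A_{il}(\widehat\nabla_n)_l\mathcal X^j$ and $\overline A=\langle A+A\widehat\nabla_n\mathcal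 X\rangle$, the matrix-valued equation $$-\widehat\Delta_n\mathcal U+\tau^2\mathcal U=\overline A-A-A\widehat\nabla_n\mathcal X\quad\text{in }\mathbb{T}^{d\times n}$$ has a smooth bounded solution $\mathcal U$. It is unique up to null sets among all square integrable (in particular, all bounded) weak solutions on $\mathbb{T}^{d\times n}$, and $$\|\widehat\nabla_n^2\mathcal U\|_{L^\infty}+\|\widehat\nabla_n\mathcal U\|_{L^\infty}+\|\mathcal U\|_{L^\infty}\le C.$$ -/

import Mathlib

open MeasureTheory
open scoped ContDiff Nat ENNReal

noncomputable section

/-- The variable `y = (y_1, …, y_n)` with `y_i ∈ ℝ^d`; the coordinate `(i, k)` is `y_i^k`. -/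
abbrev MVar (n d : ℕ) : Type := Fin n × Fin d → ℝ

/-- `f` is 1-periodic in every `y_i`, i.e. it is a function on the torus `𝕋^{d × n}`. -/
def IsTorusPeriodic {n d : ℕ} {β : Type} (f : MVar n d → β) : Prop :=
  ∀ (z : Fin n × Fin d → ℤ) (y : MVar n d), f (fun p => y p + (z p : ℝ)) = f y

/-- The unit cell of the torus, carrying the Lebesgue measure. -/
def unitCell (n d : ℕ) : Set (MVar n d) := Set.Icc 0 1

/-- The average `⟨f⟩` over the torus (whose total mass is one). -/
def torusAverage {n d : ℕ} (f : MVar n d → ℝ) : ℝ := ∫ y in unitCell n d, f y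

/-- The partial derivative of `f` in the coordinate `p = (i, k)`, i.e. in `y_i^k`. -/
def coordD {n d : ℕ} (p : Fin n × Fin d) (f : MVar n d → ℝ) (y : MVar n d) : ℝ :=
  fderiv ℝ f y (Pi.single p 1)

/-- The `k`-th component of the directional gradient `∑ i, δ_i⁻¹ ∇_{y_i}`. -/
def hatD {n d : ℕ} (δ : Fin n → ℝ) (k : Fin d) (f : MVar n d → ℝ) (y : MVar n d) : ℝ :=
  ∑ i, (δ i)⁻¹ * coordD (i, k) f y

/-- The degenerate Laplacian, the divergence of the directional gradient. -/
def hatLaplacian {n d : ℕ} (δ : Fin n → ℝ) (f : MVar n d → ℝ) (y : MVar n d) : ℝ :=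
  ∑ k, hatD δ k (hatD δ k f) y

/-- The relative scales `δ_i = ε_i / ε_1` (the first scale has index `0`). -/
def relScale {m : ℕ} (ε : Fin (m + 1) → ℝ) (i : Fin (m + 1)) : ℝ := ε i / ε 0

/-- `max_i exp (-c ε_i / ε_{i+1})` over the `m` pairs of consecutive scales. -/
def maxExpRatio {m : ℕ} (c : ℝ) (ε : Fin (m + 1) → ℝ) : ℝ :=
  ⨆ i : Fin m, Real.exp (-c * ε i.castSucc / ε i.succ)

/-- Standing assumptions on the coefficient matrix: ellipticity and boundedness with constant `lam`,
periodicity, and real analyticity with constants `C₀, Λ₀`. The absolute value of a tensor is the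
sum of the absolute values of all of its components. -/
structure IsAnalyticCoefficient {n d : ℕ} (lam C₀ Λ₀ : ℝ)
    (A : MVar n d → Matrix (Fin d) (Fin d) ℝ) : Prop where
  elliptic : ∀ (y : MVar n d) (ξ : Fin d → ℝ),
    lam * ‖WithLp.toLp 2 ξ‖ ^ 2 ≤ ξ ⬝ᵥ (A y).mulVec ξ
  bounded : ∀ (y : MVar n d) (ξ : Fin d → ℝ),
    ‖WithLp.toLp 2 ((A y).mulVec ξ)‖ ≤ lam⁻¹ * ‖WithLp.toLp 2 ξ‖
  periodic : IsTorusPeriodic A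
  smooth : ∀ a b, ContDiff ℝ ∞ (fun y => A y a b)
  analytic : ∀ (l : ℕ) (y : MVar n d),
    ∑ a, ∑ b, ∑ j : Fin l → Fin n × Fin d,
      |iteratedFDeriv ℝ l (fun z => A z a b) y (fun s => Pi.single (j s) 1)|
      ≤ C₀ * Λ₀ ^ l * (l ! : ℝ)

/-- `X = (X^1, …, X^d)` are the (smooth, periodic) multiscale correctors: for each `j`,
`-∇̂ · A ∇̂ X^j + τ² X^j = ∇̂ · (A e_j)` on the torus. -/
structure IsCorrector {n d : ℕ} (δ : Fin n → ℝ) (τ : ℝ)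
    (A : MVar n d → Matrix (Fin d) (Fin d) ℝ) (X : Fin d → MVar n d → ℝ) : Prop where
  smooth : ∀ j, ContDiff ℝ ∞ (X j)
  periodic : ∀ j, IsTorusPeriodic (X j)
  equation : ∀ j y,
    -(∑ k, hatD δ k (fun z => ∑ l, A z k l * hatD δ l (X j) z) y) + τ ^ 2 * X j y
      = ∑ k, hatD δ k (fun z => A z k j) y

/-- The entry `(i, j)` of `A + A ∇̂ X`, that is `A_ij + ∑ l, A_il ∇̂_l X^j`. -/
def corrFlux {n d : ℕ} (δ : Fin n → ℝ) (A : MVar n d → Matrix (Fin d) (Fin d) ℝ)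
    (X : Fin d → MVar n d → ℝ) (i j : Fin d) (y : MVar n d) : ℝ :=
  A y i j + ∑ l, A y i l * hatD δ l (X j) y

/-- The effective matrix `Ā = ⟨A + A ∇̂ X⟩`. -/
def effMatrix {n d : ℕ} (δ : Fin n → ℝ) (A : MVar n d → Matrix (Fin d) (Fin d) ℝ)
    (X : Fin d → MVar n d → ℝ) : Matrix (Fin d) (Fin d) ℝ :=
  fun i j => torusAverage (corrFlux δ A X i j)

/-- The entry `(i, j)` of the right-hand side `Ā - A - A ∇̂ X`. -/
def fluxSource {n d : ℕ} (δ : Fin n → ℝ) (A : MVar n d → Matrix (Fin d) (Fin d) ℝ)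
    (X : Fin d → MVar n d → ℝ) (i j : Fin d) (y : MVar n d) : ℝ :=
  effMatrix δ A X i j - A y i j - ∑ l, A y i l * hatD δ l (X j) y

/-- `U = (U_ij)` is a smooth periodic solution of `-Δ̂ U + τ² U = Ā - A - A ∇̂ X`. -/
structure IsFluxCorrector {n d : ℕ} (δ : Fin n → ℝ) (τ : ℝ)
    (A : MVar n d → Matrix (Fin d) (Fin d) ℝ) (X : Fin d → MVar n d → ℝ)
    (U : Fin d → Fin d → MVar n d → ℝ) : Prop where
  smooth : ∀ i j, ContDiff ℝ ∞ (U i j)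
  periodic : ∀ i j, IsTorusPeriodic (U i j)
  equation : ∀ i j y, -hatLaplacian δ (U i j) y + τ ^ 2 * U i j y = fluxSource δ A X i j y

/-- `V = (V_ij)` is a square integrable weak (distributional) solution on the torus of
`-Δ̂ V + τ² V = Ā - A - A ∇̂ X`; the test functions are the smooth periodic functions. Bounded
measurable periodic functions are square integrable on the cell, hence covered. -/
structure IsWeakFluxCorrector {n d : ℕ} (δ : Fin n → ℝ) (τ : ℝ)
    (A : MVar n d → Matrix (Fin d) (Fin d) ℝ) (X : Fin d → MVar n d → ℝ)
    (V : Fin d → Fin d → MVar n d → ℝ) : Prop where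
  memLp : ∀ i j, MemLp (V i j) 2 (volume.restrict (unitCell n d))
  periodic : ∀ i j, IsTorusPeriodic (V i j)
  equation : ∀ i j (η : MVar n d → ℝ), ContDiff ℝ ∞ η → IsTorusPeriodic η →
    ∫ y in unitCell n d, V i j y * (-hatLaplacian δ η y + τ ^ 2 * η y)
      = ∫ y in unitCell n d, fluxSource δ A X i j y * η y

/-- The `L^∞` norm of a scalar function. -/
def normLinf {n d : ℕ} (f : MVar n d → ℝ) : ℝ≥0∞ := eLpNorm f ⊤ volume

/-- `‖∇̂² U‖_∞ + ‖∇̂ U‖_∞ + ‖U‖_∞`, the norm of a tensor-valued function being the sum of the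
norms of its components. -/
def fluxNorm {n d : ℕ} (δ : Fin n → ℝ) (U : Fin d → Fin d → MVar n d → ℝ) : ℝ≥0∞ :=
  (∑ i, ∑ j, ∑ k, ∑ l, normLinf (hatD δ k (hatD δ l (U i j))))
    + (∑ i, ∑ j, ∑ k, normLinf (hatD δ k (U i j)))
    + ∑ i, ∑ j, normLinf (U i j)

end

/-!
The operator `∇̂` acts on the mode `exp (2πi k·y)` as multiplication by `i κ(k)` with the real vector
`κ(k) = 2π ∑ i, δ_i⁻¹ k_i ∈ ℝ^d` (`hatFreq`). It is degenerate, since `κ(k)` may be small although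
`k ≠ 0`. Two facts make this harmless.

*Resonances are rare.* If `k ≠ 0` and `|κ(k)| < 1`, then the last block `k_i ≠ 0`, which enters with
the largest factor `δ_i⁻¹`, is cancelled by the preceding ones, whose factors are at most
`δ_{i-1}⁻¹`. Hence `|k|₁ ≥ ε_{i-1} / ε_i` (`exists_ratio_le_modeSize`), so that
`τ ≥ K⁻¹ exp (-c |k|₁)` by the choice of `τ`, and `(|κ(k)|² + τ²)⁻¹ ≤ K² exp (2c |k|₁)` for all
`k ≠ 0` (`inv_multiplier_le`).

*The flux is analytic, uniformly in the scales and in `τ`.* The Fourier coefficients of `A` decay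
exponentially (`norm_realCoeff_le_exp`). Conjugating `-∇̂ · A ∇̂` with the weights `exp (ρ |k|₁)`
perturbs the symbol by a convolution operator whose norm tends to zero with `ρ`, by Schur's test;
so for small `ρ`, depending on `λ`, coercivity survives (`weighted_coercive`), and the energy
estimate with weights (`weighted_energy`) bounds `∇̂ X` in a space of analytic functions. It is
uniform because `∇̂` commutes with the weights and only `∇̂ X`, never `X`, has to be estimated.
The same estimate makes the Galerkin systems solvable, and their solutions converge to the
correctors (`exists_solution`, `exists_corrector`). Thus the coefficients of
`Ā - A - A ∇̂ X` are at most `G exp (-ρ |k|₁)`, and the one at `k = 0` vanishes.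

The flux corrector is then obtained by dividing by `|κ(k)|² + τ²`. With `2c = ρ / 2` at least half of
the exponential decay is left, for `U`, `∇̂ U` and `∇̂² U` alike (`fluxNorm_le`). Uniqueness of `X`
is the energy identity (`IsCorrector.unique`). Uniqueness of `U` among weak solutions follows by
testing with the modes, which are eigenfunctions of `-Δ̂ + τ²` (`IsWeakFluxCorrector.ae_eq`).
-/

noncomputable section

/-! ### Fourier modes and exponentially decaying coefficient sequences -/

section Modes

variable {ι : Type*} [Fintype ι]

/-- The `ℓ¹` size `∑ p, |k p|` of a frequency `k ∈ ℤ^ι`. -/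
def modeSize (k : ι → ℤ) : ℝ := ∑ p, |(k p : ℝ)|

/-- The linear form `y ↦ 2πi k·y`. -/
def modeLin (k : ι → ℤ) : (ι → ℝ) →L[ℝ] ℂ :=
  ∑ p, (ContinuousLinearMap.proj p : (ι → ℝ) →L[ℝ] ℝ).smulRight
    (2 * Real.pi * Complex.I * (k p : ℂ))

/-- The character `y ↦ exp (2πi k·y)` of the torus. -/
def mode (k : ι → ℤ) (y : ι → ℝ) : ℂ := Complex.exp (modeLin k y)

/-- The function `y ↦ ∑ k, a k exp (2πi k·y)` with Fourier coefficients `a`. -/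
def fourierSum (a : (ι → ℤ) → ℂ) (y : ι → ℝ) : ℂ := ∑' k, a k * mode k y

/-- Exponential decay of a family of Fourier coefficients. -/
def ExpDecay (a : (ι → ℤ) → ℂ) : Prop :=
  ∃ ρ : ℝ, 0 < ρ ∧ ∃ C : ℝ, ∀ k, ‖a k‖ ≤ C * Real.exp (-ρ * modeSize k)

theorem modeSize_nonneg (k : ι → ℤ) : 0 ≤ modeSize k :=
  Finset.sum_nonneg fun _ _ => abs_nonneg _

theorem modeSize_add_le (k l : ι → ℤ) : modeSize (k + l) ≤ modeSize k + modeSize l := by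
  unfold modeSize
  rw [← Finset.sum_add_distrib]
  refine Finset.sum_le_sum fun p _ => ?_
  simpa using abs_add_le (k p : ℝ) (l p : ℝ)

theorem modeSize_neg (k : ι → ℤ) : modeSize (-k) = modeSize k := by
  simp [modeSize]

theorem abs_le_modeSize (k : ι → ℤ) (p : ι) : |(k p : ℝ)| ≤ modeSize k :=
  Finset.single_le_sum (f := fun p => |(k p : ℝ)|) (fun _ _ => abs_nonneg _) (Finset.mem_univ p)

theorem modeLin_apply (k : ι → ℤ) (y : ι → ℝ) :
    modeLin k y = ∑ p, (y p : ℂ) * (2 * Real.pi * Complex.I * (k p : ℂ)) := by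
  simp [modeLin]

theorem modeLin_eq (k : ι → ℤ) (y : ι → ℝ) :
    modeLin k y = ((∑ p, y p * (2 * Real.pi * (k p : ℝ)) : ℝ) : ℂ) * Complex.I := by
  rw [modeLin_apply]
  push_cast
  rw [Finset.sum_mul]
  exact Finset.sum_congr rfl fun p _ => by ring

theorem norm_modeLin_le (k : ι → ℤ) : ‖modeLin k‖ ≤ 2 * Real.pi * modeSize k := by
  refine ContinuousLinearMap.opNorm_le_bound _
    (mul_nonneg (by positivity) (modeSize_nonneg k)) fun y => ?_
  rw [modeLin_apply]
  refine (norm_sum_le _ _).trans ?_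
  unfold modeSize
  rw [Finset.mul_sum, Finset.sum_mul]
  refine Finset.sum_le_sum fun p _ => ?_
  have h1 : ‖y p‖ ≤ ‖y‖ := norm_le_pi_norm y p
  have h2 : ‖(y p : ℂ) * (2 * Real.pi * Complex.I * (k p : ℂ))‖
      = ‖y p‖ * (2 * Real.pi * |(k p : ℝ)|) := by
    simp [abs_of_pos Real.pi_pos]
  rw [h2, mul_comm]
  gcongr

theorem norm_mode (k : ι → ℤ) (y : ι → ℝ) : ‖mode k y‖ = 1 := by
  rw [mode, modeLin_eq, Complex.norm_exp_ofReal_mul_I]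

theorem mode_zero (y : ι → ℝ) : mode 0 y = 1 := by simp [mode, modeLin_apply]

theorem mode_add (k l : ι → ℤ) (y : ι → ℝ) : mode (k + l) y = mode k y * mode l y := by
  unfold mode
  rw [← Complex.exp_add]
  congr 1
  simp only [modeLin_apply, ← Finset.sum_add_distrib]
  exact Finset.sum_congr rfl fun p _ => by push_cast [Pi.add_apply]; ring

theorem mode_neg (k : ι → ℤ) (y : ι → ℝ) :
    mode (-k) y = (starRingEnd ℂ) (mode k y) := by
  unfold mode
  rw [← Complex.exp_conj]
  congr 1
  simp only [modeLin_eq, map_mul, Complex.conj_ofReal, Complex.conj_I]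
  simp

theorem mode_periodic (k z : ι → ℤ) (y : ι → ℝ) :
    mode k (fun p => y p + (z p : ℝ)) = mode k y := by
  unfold mode
  rw [Complex.exp_eq_exp_iff_exists_int]
  refine ⟨∑ p, z p * k p, ?_⟩
  simp only [modeLin_apply]
  push_cast
  rw [Finset.sum_mul, ← Finset.sum_add_distrib]
  exact Finset.sum_congr rfl fun p _ => by ring

theorem hasFDerivAt_mode (k : ι → ℤ) (y : ι → ℝ) :
    HasFDerivAt (mode k) (mode k y • modeLin k) y :=
  (modeLin k).hasFDerivAt.cexp

theorem contDiff_mode (k : ι → ℤ) : ContDiff ℝ ∞ (mode k) :=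
  (modeLin k).contDiff.cexp

theorem continuous_mode (k : ι → ℤ) : Continuous (mode k) := (contDiff_mode k).continuous

theorem modeLin_single [DecidableEq ι] (k : ι → ℤ) (p : ι) :
    modeLin k (Pi.single p 1) = 2 * Real.pi * Complex.I * (k p : ℂ) := by
  rw [modeLin_apply, Finset.sum_eq_single p]
  · simp
  · intro q _ hq
    simp [hq]
  · simp

/-- Lattice sums of exponentials converge: finite partial sums are bounded by the product of the
one-dimensional sums. -/
theorem summable_exp_modeSize {ρ : ℝ} (hρ : 0 < ρ) :
    Summable fun k : ι → ℤ => Real.exp (-ρ * modeSize k) := by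
  classical
  have h1 : Summable fun j : ℤ => Real.exp (-ρ * |(j : ℝ)|) := by
    have hn : Summable fun j : ℕ => Real.exp (-ρ * |(j : ℝ)|) := by
      have := Real.summable_exp_nat_mul_of_ge (c := -ρ) (by linarith) (f := fun j => (j : ℝ))
        (fun _ => le_rfl)
      simpa using this
    exact Summable.of_nat_of_neg (by simpa using hn) (by simpa using hn)
  have h2 : ∀ k : ι → ℤ, Real.exp (-ρ * modeSize k) = ∏ p, Real.exp (-ρ * |(k p : ℝ)|) := by
    intro k
    rw [← Real.exp_sum, modeSize, Finset.mul_sum]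
  refine summable_of_sum_le (c := ∏ _p : ι, ∑' j : ℤ, Real.exp (-ρ * |(j : ℝ)|))
    (fun _ => (Real.exp_pos _).le) fun s => ?_
  have hs : s ⊆ Fintype.piFinset fun p => s.image fun k : ι → ℤ => k p := by
    intro k hk
    rw [Fintype.mem_piFinset]
    exact fun p => Finset.mem_image_of_mem _ hk
  calc ∑ k ∈ s, Real.exp (-ρ * modeSize k)
      ≤ ∑ k ∈ Fintype.piFinset fun p => s.image fun k : ι → ℤ => k p, Real.exp (-ρ * modeSize k) :=
        Finset.sum_le_sum_of_subset_of_nonneg hs fun _ _ _ => (Real.exp_pos _).le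
    _ = ∏ p, ∑ j ∈ s.image fun k : ι → ℤ => k p, Real.exp (-ρ * |(j : ℝ)|) := by
        rw [Finset.prod_univ_sum]
        exact Finset.sum_congr rfl fun k _ => h2 k
    _ ≤ _ := by
        refine Finset.prod_le_prod (fun p _ => Finset.sum_nonneg fun _ _ => (Real.exp_pos _).le)
          fun p _ => ?_
        exact h1.sum_le_tsum _ fun _ _ => (Real.exp_pos _).le

theorem ExpDecay.summable {a : (ι → ℤ) → ℂ} (ha : ExpDecay a) : Summable fun k => ‖a k‖ := by
  obtain ⟨ρ, hρ, C, h⟩ := ha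
  exact Summable.of_nonneg_of_le (fun _ => norm_nonneg _) h
    ((summable_exp_modeSize hρ).mul_left C)

theorem mul_exp_le {ρ t : ℝ} (hρ : 0 < ρ) (ht : 0 ≤ t) :
    (1 + t) * Real.exp (-ρ * t) ≤ (1 + 2 / ρ) * Real.exp (-(ρ / 2) * t) := by
  have h1 : ρ / 2 * t ≤ Real.exp (ρ / 2 * t) := by
    linarith [Real.add_one_le_exp (ρ / 2 * t)]
  have h2 : 1 ≤ Real.exp (ρ / 2 * t) := Real.one_le_exp (by positivity)
  have h3 : t ≤ 2 / ρ * Real.exp (ρ / 2 * t) := by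
    calc t = 2 / ρ * (ρ / 2 * t) := by field_simp
      _ ≤ _ := by gcongr
  have h4 : Real.exp (-(ρ / 2) * t) = Real.exp (ρ / 2 * t) * Real.exp (-ρ * t) := by
    rw [← Real.exp_add]; congr 1; ring
  rw [h4, ← mul_assoc]
  gcongr
  linarith

/-- Multiplying by a factor of linear growth, as differentiation does, preserves exponential
decay. -/
theorem ExpDecay.of_le_linear {a b : (ι → ℤ) → ℂ} (ha : ExpDecay a) (B : ℝ)
    (h : ∀ k, ‖b k‖ ≤ B * (1 + modeSize k) * ‖a k‖) : ExpDecay b := by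
  obtain ⟨ρ, hρ, C, hC⟩ := ha
  refine ⟨ρ / 2, by positivity, |B| * |C| * (1 + 2 / ρ), fun k => ?_⟩
  have hs := modeSize_nonneg k
  calc ‖b k‖ ≤ B * (1 + modeSize k) * ‖a k‖ := h k
    _ ≤ |B| * (1 + modeSize k) * (|C| * Real.exp (-ρ * modeSize k)) := by
        have h1 : ‖a k‖ ≤ |C| * Real.exp (-ρ * modeSize k) := (hC k).trans (by
          gcongr; exact le_abs_self C)
        have h2 : B * (1 + modeSize k) ≤ |B| * (1 + modeSize k) := by
          gcongr; exact le_abs_self B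
        exact mul_le_mul h2 h1 (norm_nonneg _) (by positivity)
    _ = |B| * |C| * ((1 + modeSize k) * Real.exp (-ρ * modeSize k)) := by ring
    _ ≤ |B| * |C| * ((1 + 2 / ρ) * Real.exp (-(ρ / 2) * modeSize k)) := by
        gcongr _ * ?_
        exact mul_exp_le hρ hs
    _ = _ := by ring

theorem ExpDecay.of_le {a b : (ι → ℤ) → ℂ} (ha : ExpDecay a) (B : ℝ)
    (h : ∀ k, ‖b k‖ ≤ B * ‖a k‖) : ExpDecay b := by
  refine ha.of_le_linear |B| fun k => (h k).trans ?_
  have : B ≤ |B| * (1 + modeSize k) := by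
    nlinarith [le_abs_self B, abs_nonneg B, modeSize_nonneg k]
  gcongr

theorem ExpDecay.const_mul {a : (ι → ℤ) → ℂ} (ha : ExpDecay a) (c : ℂ) :
    ExpDecay fun k => c * a k :=
  ha.of_le ‖c‖ fun _ => (norm_mul _ _).le

theorem ExpDecay.freq_mul {a : (ι → ℤ) → ℂ} (ha : ExpDecay a) (p : ι) :
    ExpDecay fun k => 2 * Real.pi * Complex.I * (k p : ℂ) * a k := by
  refine ha.of_le_linear (2 * Real.pi) fun k => ?_
  have : ‖2 * Real.pi * Complex.I * (k p : ℂ) * a k‖ = 2 * Real.pi * |(k p : ℝ)| * ‖a k‖ := by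
    simp [abs_of_pos Real.pi_pos]
  rw [this]
  gcongr
  linarith [abs_le_modeSize k p]

theorem ExpDecay.zero : ExpDecay (fun _ : ι → ℤ => (0 : ℂ)) :=
  ⟨1, one_pos, 0, fun k => by simp⟩

theorem ExpDecay.add {a b : (ι → ℤ) → ℂ} (ha : ExpDecay a) (hb : ExpDecay b) :
    ExpDecay fun k => a k + b k := by
  obtain ⟨ρ, hρ, C, hC⟩ := ha
  obtain ⟨σ, hσ, D, hD⟩ := hb
  refine ⟨min ρ σ, lt_min hρ hσ, |C| + |D|, fun k => ?_⟩
  have hs := modeSize_nonneg k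
  have h1 : ‖a k‖ ≤ |C| * Real.exp (-(min ρ σ) * modeSize k) := by
    refine (hC k).trans ?_
    gcongr
    · exact le_abs_self C
    · exact min_le_left _ _
  have h2 : ‖b k‖ ≤ |D| * Real.exp (-(min ρ σ) * modeSize k) := by
    refine (hD k).trans ?_
    gcongr
    · exact le_abs_self D
    · exact min_le_right _ _
  rw [add_mul]
  exact (norm_add_le _ _).trans (add_le_add h1 h2)

theorem ExpDecay.sum {κ : Type*} (s : Finset κ) {a : κ → (ι → ℤ) → ℂ}
    (ha : ∀ i ∈ s, ExpDecay (a i)) : ExpDecay fun k => ∑ i ∈ s, a i k := by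
  classical
  induction s using Finset.induction_on with
  | empty => simpa using ExpDecay.zero
  | insert i s hi ih =>
    simp only [Finset.sum_insert hi]
    exact (ha i (Finset.mem_insert_self i s)).add
      (ih fun j hj => ha j (Finset.mem_insert_of_mem hj))

/-! ### Fourier series with exponentially decaying coefficients -/

theorem norm_mul_mode (c : ℂ) (k : ι → ℤ) (y : ι → ℝ) : ‖c * mode k y‖ = ‖c‖ := by
  rw [norm_mul, norm_mode, mul_one]

theorem ExpDecay.summable_mul_mode {a : (ι → ℤ) → ℂ} (ha : ExpDecay a) (y : ι → ℝ) :
    Summable fun k => a k * mode k y :=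
  Summable.of_norm (by simpa only [norm_mul_mode] using ha.summable)

theorem norm_fourierSum_le {a : (ι → ℤ) → ℂ} (ha : ExpDecay a) (y : ι → ℝ) :
    ‖fourierSum a y‖ ≤ ∑' k, ‖a k‖ := by
  refine (norm_tsum_le_tsum_norm (by simpa only [norm_mul_mode] using ha.summable)).trans ?_
  simp only [norm_mul_mode, le_refl]

theorem fourierSum_periodic (a : (ι → ℤ) → ℂ) (z : ι → ℤ) (y : ι → ℝ) :
    fourierSum a (fun p => y p + (z p : ℝ)) = fourierSum a y := by
  simp only [fourierSum, mode_periodic]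

theorem fourierSum_add {a b : (ι → ℤ) → ℂ} (ha : ExpDecay a) (hb : ExpDecay b) (y : ι → ℝ) :
    fourierSum (fun k => a k + b k) y = fourierSum a y + fourierSum b y := by
  simp only [fourierSum, add_mul]
  exact (ha.summable_mul_mode y).tsum_add (hb.summable_mul_mode y)

theorem fourierSum_const_mul (a : (ι → ℤ) → ℂ) (c : ℂ) (y : ι → ℝ) :
    fourierSum (fun k => c * a k) y = c * fourierSum a y := by
  simp only [fourierSum, mul_assoc]
  exact tsum_mul_left

theorem fourierSum_sum {κ : Type*} (s : Finset κ) {a : κ → (ι → ℤ) → ℂ}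
    (ha : ∀ i ∈ s, ExpDecay (a i)) (y : ι → ℝ) :
    fourierSum (fun k => ∑ i ∈ s, a i k) y = ∑ i ∈ s, fourierSum (a i) y := by
  simp only [fourierSum, Finset.sum_mul]
  exact Summable.tsum_finsetSum fun i hi => (ha i hi).summable_mul_mode y

theorem hasFDerivAt_fourierSum {a : (ι → ℤ) → ℂ} (ha : ExpDecay a) (y : ι → ℝ) :
    HasFDerivAt (fourierSum a) (∑' k, a k • (mode k y • modeLin k)) y := by
  have hb : ExpDecay fun k => ((2 * Real.pi * modeSize k : ℝ) : ℂ) * a k := by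
    refine ha.of_le_linear (2 * Real.pi) fun k => ?_
    rw [norm_mul, Complex.norm_real, Real.norm_of_nonneg
      (mul_nonneg (by positivity) (modeSize_nonneg k))]
    gcongr
    linarith
  have h1 : ∀ (k : ι → ℤ) (x : ι → ℝ),
      HasFDerivAt (fun x => a k * mode k x) (a k • (mode k x • modeLin k)) x :=
    fun k x => (hasFDerivAt_mode k x).const_mul (a k)
  have h2 : ∀ (k : ι → ℤ) (x : ι → ℝ), ‖a k • (mode k x • modeLin k)‖
      ≤ ‖((2 * Real.pi * modeSize k : ℝ) : ℂ) * a k‖ := by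
    intro k x
    rw [norm_smul, norm_smul, norm_mode, one_mul, norm_mul, Complex.norm_real,
      Real.norm_of_nonneg (mul_nonneg (by positivity) (modeSize_nonneg k)), mul_comm]
    gcongr
    exact norm_modeLin_le k
  exact hasFDerivAt_tsum hb.summable h1 h2 (ha.summable_mul_mode y) y

theorem summable_fderiv_fourierSum {a : (ι → ℤ) → ℂ} (ha : ExpDecay a) (y : ι → ℝ) :
    Summable fun k => a k • (mode k y • modeLin k) := by
  have hb : ExpDecay fun k => ((2 * Real.pi * modeSize k : ℝ) : ℂ) * a k := by
    refine ha.of_le_linear (2 * Real.pi) fun k => ?_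
    rw [norm_mul, Complex.norm_real, Real.norm_of_nonneg
      (mul_nonneg (by positivity) (modeSize_nonneg k))]
    gcongr
    linarith
  refine Summable.of_norm_bounded hb.summable fun k => ?_
  rw [norm_smul, norm_smul, norm_mode, one_mul, norm_mul, Complex.norm_real,
      Real.norm_of_nonneg (mul_nonneg (by positivity) (modeSize_nonneg k)), mul_comm]
  gcongr
  exact norm_modeLin_le k

theorem fderiv_fourierSum_single [DecidableEq ι] {a : (ι → ℤ) → ℂ} (ha : ExpDecay a) (y : ι → ℝ)
    (p : ι) : fderiv ℝ (fourierSum a) y (Pi.single p 1)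
      = fourierSum (fun k => 2 * Real.pi * Complex.I * (k p : ℂ) * a k) y := by
  rw [(hasFDerivAt_fourierSum ha y).fderiv]
  have h := (summable_fderiv_fourierSum ha y).hasSum.mapL
    (ContinuousLinearMap.apply ℝ ℂ (Pi.single p 1 : ι → ℝ))
  have h2 := h.tsum_eq
  simp only [ContinuousLinearMap.apply_apply] at h2
  rw [← h2]
  refine tsum_congr fun k => ?_
  simp only [_root_.smul_apply, modeLin_single, smul_eq_mul]
  ring

theorem contDiff_fourierSum {a : (ι → ℤ) → ℂ} (ha : ExpDecay a) :
    ContDiff ℝ ∞ (fourierSum a) := by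
  classical
  rw [contDiff_infty]
  intro n
  induction n generalizing a with
  | zero =>
    exact contDiff_zero.2 (continuous_iff_continuousAt.2 fun y =>
      (hasFDerivAt_fourierSum ha y).continuousAt)
  | succ n ih =>
    push_cast
    rw [contDiff_succ_iff_fderiv_apply]
    refine ⟨fun y => (hasFDerivAt_fourierSum ha y).differentiableAt, by simp, fun v => ?_⟩
    have hv : (fun x => fderiv ℝ (fourierSum a) x v)
        = fun x => ∑ p, (v p : ℂ) *
          fourierSum (fun k => 2 * Real.pi * Complex.I * (k p : ℂ) * a k) x := by
      funext x
      conv_lhs => rw [pi_eq_sum_univ' v]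
      rw [map_sum]
      refine Finset.sum_congr rfl fun p _ => ?_
      rw [map_smul]
      rw [← fderiv_fourierSum_single ha x p, ← Complex.real_smul]
    rw [hv]
    exact ContDiff.sum fun p _ => contDiff_const.mul (ih (ha.freq_mul p))

theorem continuous_fourierSum {a : (ι → ℤ) → ℂ} (ha : ExpDecay a) : Continuous (fourierSum a) :=
  (contDiff_fourierSum ha).continuous

/-- The Fourier coefficients of a product. -/
def fourierConv (a b : (ι → ℤ) → ℂ) (k : ι → ℤ) : ℂ := ∑' l, a (k - l) * b l

theorem exp_modeSize_mul_le {ρ : ℝ} (hρ : 0 ≤ ρ) (k l : ι → ℤ) :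
    Real.exp (-ρ * modeSize (k - l)) * Real.exp (-ρ * modeSize l)
      ≤ Real.exp (-ρ * modeSize k) := by
  rw [← Real.exp_add]
  apply Real.exp_le_exp.2
  have := modeSize_add_le (k - l) l
  rw [sub_add_cancel] at this
  nlinarith

theorem summable_exp_modeSize_sub {ρ : ℝ} (hρ : 0 < ρ) (k : ι → ℤ) :
    Summable fun l : ι → ℤ => Real.exp (-ρ * modeSize (k - l)) :=
  (Equiv.subLeft k).summable_iff.2 (summable_exp_modeSize hρ)

theorem tsum_exp_modeSize_sub (ρ : ℝ) (k : ι → ℤ) :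
    ∑' l : ι → ℤ, Real.exp (-ρ * modeSize (k - l)) = ∑' l : ι → ℤ, Real.exp (-ρ * modeSize l) :=
  (Equiv.subLeft k).tsum_eq fun l : ι → ℤ => Real.exp (-ρ * modeSize l)

/-- The convolution decays at the slower one of two rates, if these differ. -/
theorem norm_fourierConv_le {a b : (ι → ℤ) → ℂ} {ρ Ca Cb : ℝ} (hρ : 0 < ρ)
    (ha : ∀ k, ‖a k‖ ≤ Ca * Real.exp (-(2 * ρ) * modeSize k))
    (hb : ∀ k, ‖b k‖ ≤ Cb * Real.exp (-ρ * modeSize k)) (k : ι → ℤ) :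
    ‖fourierConv a b k‖
      ≤ Ca * Cb * (∑' l : ι → ℤ, Real.exp (-ρ * modeSize l)) * Real.exp (-ρ * modeSize k) := by
  have hCa : 0 ≤ Ca := by
    have := (norm_nonneg _).trans (ha 0)
    exact nonneg_of_mul_nonneg_left this (Real.exp_pos _)
  have hCb : 0 ≤ Cb := by
    have := (norm_nonneg _).trans (hb 0)
    exact nonneg_of_mul_nonneg_left this (Real.exp_pos _)
  have h : ∀ l, ‖a (k - l) * b l‖
      ≤ Ca * Cb * Real.exp (-ρ * modeSize k) * Real.exp (-ρ * modeSize (k - l)) := by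
    intro l
    rw [norm_mul]
    calc ‖a (k - l)‖ * ‖b l‖
        ≤ (Ca * Real.exp (-(2 * ρ) * modeSize (k - l))) * (Cb * Real.exp (-ρ * modeSize l)) :=
          mul_le_mul (ha _) (hb _) (norm_nonneg _) (by positivity)
      _ = Ca * Cb * (Real.exp (-ρ * modeSize (k - l)) * Real.exp (-ρ * modeSize l))
            * Real.exp (-ρ * modeSize (k - l)) := by
          have : Real.exp (-(2 * ρ) * modeSize (k - l))
              = Real.exp (-ρ * modeSize (k - l)) * Real.exp (-ρ * modeSize (k - l)) := by
            rw [← Real.exp_add]; congr 1; ring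
          rw [this]; ring
      _ ≤ _ := by
          gcongr
          exact exp_modeSize_mul_le hρ.le k l
  have hs := (summable_exp_modeSize_sub hρ k).mul_left (Ca * Cb * Real.exp (-ρ * modeSize k))
  refine (tsum_of_norm_bounded hs.hasSum h).trans (le_of_eq ?_)
  rw [tsum_mul_left, tsum_exp_modeSize_sub]
  ring

theorem ExpDecay.conv {a b : (ι → ℤ) → ℂ} (ha : ExpDecay a) (hb : ExpDecay b) :
    ExpDecay (fourierConv a b) := by
  obtain ⟨ρ, hρ, C, hC⟩ := ha
  obtain ⟨σ, hσ, D, hD⟩ := hb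
  have hmin : 0 < min (ρ / 2) σ := lt_min (by positivity) hσ
  refine ⟨min (ρ / 2) σ, hmin, _, norm_fourierConv_le (Ca := |C|) (Cb := |D|) hmin
    (fun k => (hC k).trans ?_) (fun k => (hD k).trans ?_)⟩
  · have hs := modeSize_nonneg k
    have : 2 * min (ρ / 2) σ ≤ ρ := by linarith [min_le_left (ρ / 2) σ]
    gcongr
    exact le_abs_self C
  · have hs := modeSize_nonneg k
    have := min_le_right (ρ / 2) σ
    gcongr
    exact le_abs_self D

theorem fourierSum_mul {a b : (ι → ℤ) → ℂ} (ha : ExpDecay a) (hb : ExpDecay b) (y : ι → ℝ) :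
    fourierSum a y * fourierSum b y = fourierSum (fourierConv a b) y := by
  have ha' : Summable fun k => ‖a k * mode k y‖ := by
    simpa only [norm_mul_mode] using ha.summable
  have hb' : Summable fun k => ‖b k * mode k y‖ := by
    simpa only [norm_mul_mode] using hb.summable
  have hs : Summable fun x : (ι → ℤ) × (ι → ℤ) => a x.1 * mode x.1 y * (b x.2 * mode x.2 y) :=
    summable_mul_of_summable_norm (f := fun k => a k * mode k y) (g := fun k => b k * mode k y)
      ha' hb'
  obtain ⟨e, he⟩ : ∃ e : (ι → ℤ) × (ι → ℤ) ≃ (ι → ℤ) × (ι → ℤ),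
      ∀ x, e x = (x.1 - x.2, x.2) :=
    ⟨{ toFun := fun x => (x.1 - x.2, x.2)
       invFun := fun x => (x.1 + x.2, x.2)
       left_inv := fun x => Prod.ext (sub_add_cancel _ _) rfl
       right_inv := fun x => Prod.ext (add_sub_cancel_right _ _) rfl }, fun _ => rfl⟩
  have hs' : Summable fun x : (ι → ℤ) × (ι → ℤ) => a (x.1 - x.2) * b x.2 * mode x.1 y := by
    refine (e.summable_iff.2 hs).congr fun x => ?_
    have : mode x.1 y = mode (x.1 - x.2) y * mode x.2 y := by rw [← mode_add, sub_add_cancel]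
    rw [Function.comp_apply, he, this]
    ring
  calc fourierSum a y * fourierSum b y
      = ∑' x : (ι → ℤ) × (ι → ℤ), a x.1 * mode x.1 y * (b x.2 * mode x.2 y) :=
        tsum_mul_tsum_of_summable_norm ha' hb'
    _ = ∑' x : (ι → ℤ) × (ι → ℤ), a (x.1 - x.2) * b x.2 * mode x.1 y := by
        rw [← e.tsum_eq fun x : (ι → ℤ) × (ι → ℤ) => a x.1 * mode x.1 y * (b x.2 * mode x.2 y)]
        refine tsum_congr fun x => ?_
        have : mode x.1 y = mode (x.1 - x.2) y * mode x.2 y := by rw [← mode_add, sub_add_cancel]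
        rw [he, this]
        ring
    _ = ∑' k, ∑' l, a (k - l) * b l * mode k y := hs'.tsum_prod
    _ = fourierSum (fourierConv a b) y := by
        refine tsum_congr fun k => ?_
        rw [tsum_mul_right, fourierConv]

end Modes

/-! ### Integration over the unit cell and uniqueness of Fourier coefficients -/

section Cell

variable {ι : Type*} [Fintype ι]

/-- The measure on the circle normalised as in the theory of Fourier series on `UnitAddTorus`. -/
local instance : MeasureSpace UnitAddCircle := ⟨AddCircle.haarAddCircle⟩

theorem mode_eq_mFourier (k : ι → ℤ) (y : ι → ℝ) :
    mode k y = UnitAddTorus.mFourier k (fun p => (y p : UnitAddCircle)) := by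
  simp only [mode, modeLin_apply, Complex.exp_sum, UnitAddTorus.mFourier, ContinuousMap.coe_mk,
    fourier_coe_apply]
  refine Finset.prod_congr rfl fun p _ => ?_
  congr 1
  push_cast
  ring

theorem ioc_box_ae_eq_Icc (a : ι → ℝ) :
    {x : ι → ℝ | ∀ i, x i ∈ Set.Ioc (a i) (a i + 1)} =ᵐ[volume] Set.Icc a (a + 1) := by
  have h := Measure.univ_pi_Ioc_ae_eq_Icc (μ := fun _ : ι => (volume : Measure ℝ)) (f := a)
    (g := a + 1)
  have hset : {x : ι → ℝ | ∀ i, x i ∈ Set.Ioc (a i) (a i + 1)}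
      = Set.univ.pi fun i => Set.Ioc (a i) ((a + 1) i) := by
    ext x
    simp
  rw [hset]
  exact h

theorem integral_cell_eq_torus (F : UnitAddTorus ι → ℂ) (a : ι → ℝ) :
    ∫ x, F x = ∫ y in Set.Icc a (a + 1), F (fun p => (y p : UnitAddCircle)) := by
  rw [UnitAddTorus.integral_preimage F a]
  exact setIntegral_congr_set (ioc_box_ae_eq_Icc a)

omit [Fintype ι] in
theorem exists_torus_lift {f : (ι → ℝ) → ℂ}
    (hf : ∀ (z : ι → ℤ) (y : ι → ℝ), f (fun p => y p + (z p : ℝ)) = f y) :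
    ∃ F : UnitAddTorus ι → ℂ, ∀ y, f y = F (fun p => (y p : UnitAddCircle)) := by
  refine ⟨fun x => f fun p => (AddCircle.equivIoc 1 0 (x p)).1, fun y => ?_⟩
  have h : ∀ p, ∃ z : ℤ, (AddCircle.equivIoc 1 0 (y p : UnitAddCircle)).1 = y p + (z : ℝ) := by
    intro p
    have h1 : (((AddCircle.equivIoc 1 0 (y p : UnitAddCircle)).1 : ℝ) : UnitAddCircle) = y p :=
      AddCircle.coe_equivIoc ..
    have h2 : (((AddCircle.equivIoc 1 0 (y p : UnitAddCircle)).1 - y p : ℝ) : UnitAddCircle) = 0 := by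
      rw [AddCircle.coe_sub, h1, sub_self]
    obtain ⟨z, hz⟩ := (AddCircle.coe_eq_zero_iff (1 : ℝ)).1 h2
    refine ⟨z, ?_⟩
    rw [zsmul_eq_mul, mul_one] at hz
    linarith
  choose z hz using h
  simp only [hz, hf]

/-- The integral of a periodic function over a unit cell does not depend on the cell. -/
theorem integral_cell_translate {f : (ι → ℝ) → ℂ}
    (hf : ∀ (z : ι → ℤ) (y : ι → ℝ), f (fun p => y p + (z p : ℝ)) = f y) (v : ι → ℝ) :
    ∫ y in Set.Icc 0 1, f (y + v) = ∫ y in Set.Icc 0 1, f y := by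
  obtain ⟨F, hF⟩ := exists_torus_lift hf
  have h1 : ∫ y in Set.Icc 0 1, f y = ∫ y in Set.Icc v (v + 1), f y := by
    simp only [hF]
    rw [← integral_cell_eq_torus F v, integral_cell_eq_torus F 0, zero_add]
  rw [h1]
  have h2 := (measurePreserving_add_right (volume : Measure (ι → ℝ)) v).setIntegral_preimage_emb
    (measurableEmbedding_addRight v) f (Set.Icc v (v + 1))
  rw [← h2]
  simp [add_comm]

/-- A square integrable function on the unit cell whose Fourier coefficients all vanish is zero. -/
theorem ae_eq_zero_of_coeff_eq_zero {W : (ι → ℝ) → ℂ}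
    (hW : MemLp W 2 (volume.restrict (Set.Icc (0 : ι → ℝ) 1)))
    (h : ∀ k : ι → ℤ, ∫ y in Set.Icc 0 1, mode k y * W y = 0) :
    W =ᵐ[volume.restrict (Set.Icc (0 : ι → ℝ) 1)] 0 := by
  set B : Set (ι → ℝ) := {x | ∀ i, x i ∈ Set.Ioc ((0 : ι → ℝ) i) ((0 : ι → ℝ) i + 1)} with hB
  have hBI : B =ᵐ[volume] Set.Icc (0 : ι → ℝ) 1 := by
    have h := ioc_box_ae_eq_Icc (0 : ι → ℝ)
    rwa [zero_add] at h
  have hBm : MeasurableSet B := MeasurableSet.univ_pi' fun i => measurableSet_Ioc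
  rw [← Measure.restrict_congr_set hBI] at hW ⊢
  set e := UnitAddTorus.measurableEquivPiIoc (0 : ι → ℝ) with he
  have hmp := UnitAddTorus.measurePreserving_equivPiIoc (0 : ι → ℝ)
  have hval : Measure.map Subtype.val (Measure.comap (Subtype.val : B → ι → ℝ) volume)
      = volume.restrict B := map_comap_subtype_coe hBm volume
  have hemb : MeasurableEmbedding (Subtype.val : B → ι → ℝ) := MeasurableEmbedding.subtype_coe hBm
  have hW1 : MemLp (fun x : B => W x.1) 2 (Measure.comap (Subtype.val : B → ι → ℝ) volume) := by
    rw [← hval] at hW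
    exact (hemb.memLp_map_measure_iff).1 hW
  have hW2 : MemLp (fun x : UnitAddTorus ι => W (e x).1) 2 volume :=
    hW1.comp_measurePreserving hmp
  have hcoeff : ∀ k, UnitAddTorus.mFourierCoeff (fun x : UnitAddTorus ι => W (e x).1) k = 0 := by
    intro k
    rw [UnitAddTorus.mFourierCoeff_eq_integral _ _ (0 : ι → ℝ)]
    rw [← h (-k), ← setIntegral_congr_set hBI]
    refine setIntegral_congr_fun hBm fun y hy => ?_
    have h1 : (e fun p => (y p : UnitAddCircle)) = (⟨y, hy⟩ : B) := by
      rw [← MeasurableEquiv.eq_symm_apply]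
      rfl
    simp only [h1, smul_eq_mul, mode_eq_mFourier]
  have hz : hW2.toLp = 0 := by
    have h1 := UnitAddTorus.hasSum_mFourier_series_L2 hW2.toLp
    refine h1.unique ?_
    have h2 : ∀ k, UnitAddTorus.mFourierCoeff (hW2.toLp : UnitAddTorus ι → ℂ) k = 0 := by
      intro k
      rw [← hcoeff k]
      refine integral_congr_ae ?_
      filter_upwards [hW2.coeFn_toLp] with x hx
      rw [hx]
    simp only [h2, zero_smul]
    exact hasSum_zero
  have hz2 : (fun x : UnitAddTorus ι => W (e x).1) =ᵐ[volume] 0 :=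
    (hW2.toLp_eq_toLp_iff MemLp.zero').1 (by rw [hz]; rfl)
  have hz3 : ∀ᵐ x ∂(Measure.comap (Subtype.val : B → ι → ℝ) volume), W x.1 = 0 := by
    have h1 := (e.measurableEmbedding.ae_map_iff (p := fun x => W x.1 = 0)).2 hz2
    rw [hmp.map_eq] at h1
    exact h1
  rw [← hval]
  exact (hemb.ae_map_iff).2 hz3

theorem integrableOn_cell {f : (ι → ℝ) → ℂ} (hf : Continuous f) :
    IntegrableOn f (Set.Icc 0 1) :=
  hf.continuousOn.integrableOn_compact isCompact_Icc

omit [Fintype ι] in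
theorem exists_shift_mem_cell (y : ι → ℝ) :
    ∃ z : ι → ℤ, (fun p => y p + (z p : ℝ)) ∈ Set.Icc (0 : ι → ℝ) 1 := by
  refine ⟨fun p => -⌊y p⌋, fun p => ?_, fun p => ?_⟩
  · simp only [Int.cast_neg, Pi.zero_apply]
    linarith [Int.floor_le (y p)]
  · simp only [Int.cast_neg, Pi.one_apply]
    linarith [Int.lt_floor_add_one (y p)]

theorem memLp_cell_of_continuous {f : (ι → ℝ) → ℂ} (hf : Continuous f) :
    MemLp f 2 (volume.restrict (Set.Icc (0 : ι → ℝ) 1)) := by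
  obtain ⟨C, hC⟩ := (isCompact_Icc (a := (0 : ι → ℝ)) (b := 1)).exists_bound_of_continuousOn
    hf.continuousOn
  have : IsFiniteMeasure (volume.restrict (Set.Icc (0 : ι → ℝ) 1)) :=
    ⟨by simpa using (isCompact_Icc (a := (0 : ι → ℝ)) (b := 1)).measure_lt_top⟩
  exact MemLp.of_bound hf.aestronglyMeasurable C
    ((ae_restrict_iff' measurableSet_Icc).2 (Filter.Eventually.of_forall hC))

theorem eqOn_cell_of_ae_eq {E : Type*} [TopologicalSpace E] [T2Space E] {f g : (ι → ℝ) → E}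
    (hf : Continuous f) (hg : Continuous g)
    (h : f =ᵐ[volume.restrict (Set.Icc (0 : ι → ℝ) 1)] g) : Set.EqOn f g (Set.Icc 0 1) := by
  refine Measure.eqOn_of_ae_eq h hf.continuousOn hg.continuousOn ?_
  rw [← Set.pi_univ_Icc, interior_pi_set Set.finite_univ, closure_pi_set]
  refine Set.pi_mono fun i _ => ?_
  simp

/-- Continuous periodic functions are determined by their Fourier coefficients. -/
theorem eq_zero_of_coeff_eq_zero {f : (ι → ℝ) → ℂ} (hc : Continuous f)
    (hf : ∀ (z : ι → ℤ) (y : ι → ℝ), f (fun p => y p + (z p : ℝ)) = f y)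
    (h : ∀ k : ι → ℤ, ∫ y in Set.Icc 0 1, mode k y * f y = 0) (y : ι → ℝ) : f y = 0 := by
  have h1 := eqOn_cell_of_ae_eq hc continuous_zero
    (ae_eq_zero_of_coeff_eq_zero (memLp_cell_of_continuous hc) h)
  obtain ⟨z, hz⟩ := exists_shift_mem_cell y
  rw [← hf z y]
  exact h1 hz

theorem fderiv_periodic {f : (ι → ℝ) → ℂ}
    (hf : ∀ (z : ι → ℤ) (y : ι → ℝ), f (fun p => y p + (z p : ℝ)) = f y)
    (z : ι → ℤ) (y : ι → ℝ) : fderiv ℝ f (fun p => y p + (z p : ℝ)) = fderiv ℝ f y := by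
  have h : (fun x => f (x + fun p => (z p : ℝ))) = f := funext fun x => hf z x
  have h2 := fderiv_comp_add_right (𝕜 := ℝ) (f := f) (x := y) fun p => (z p : ℝ)
  rw [h] at h2
  exact h2.symm

/-- On the torus, directional derivatives have mean zero. -/
theorem integral_fderiv_eq_zero {f : (ι → ℝ) → ℂ} (hc : ContDiff ℝ 1 f)
    (hf : ∀ (z : ι → ℤ) (y : ι → ℝ), f (fun p => y p + (z p : ℝ)) = f y) (p : ι) [DecidableEq ι] :
    ∫ y in Set.Icc 0 1, fderiv ℝ f y (Pi.single p 1) = 0 := by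
  set v : ι → ℝ := Pi.single p 1 with hv
  have hc' : Continuous fun y => fderiv ℝ f y v :=
    (hc.continuous_fderiv one_ne_zero).clm_apply continuous_const
  have hper : ∀ (z : ι → ℤ) (y : ι → ℝ),
      fderiv ℝ f (fun p => y p + (z p : ℝ)) v = fderiv ℝ f y v := fun z y => by
    rw [fderiv_periodic hf]
  -- The mean value over `t ∈ [0, 1]` of the derivative along a closed loop vanishes.
  have hloop : ∀ y, ∫ t in (0 : ℝ)..1, fderiv ℝ f (y + t • v) v = 0 := by
    intro y
    have h1 : ∀ t ∈ Set.uIcc (0 : ℝ) 1,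
        HasDerivAt (fun t : ℝ => f (y + t • v)) (fderiv ℝ f (y + t • v) v) t := by
      intro t _
      have h2 : HasDerivAt (fun t : ℝ => y + t • v) v t := by
        simpa using ((hasDerivAt_id t).smul_const v).const_add y
      exact ((hc.differentiable one_ne_zero) (y + t • v)).hasFDerivAt.comp_hasDerivAt t h2
    rw [intervalIntegral.integral_eq_sub_of_hasDerivAt h1
      (Continuous.intervalIntegrable (by fun_prop) _ _)]
    have h3 : y + (1 : ℝ) • v = fun q => y q + ((Pi.single p 1 : ι → ℤ) q : ℝ) := by
      funext q
      by_cases hq : q = p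
      · subst hq; simp [hv]
      · simp [hv, hq]
    rw [h3, hf]
    simp
  have hswap : ∫ y in Set.Icc (0 : ι → ℝ) 1, ∫ t in (0 : ℝ)..1, fderiv ℝ f (y + t • v) v
      = ∫ t in (0 : ℝ)..1, ∫ y in Set.Icc (0 : ι → ℝ) 1, fderiv ℝ f (y + t • v) v := by
    simp only [intervalIntegral.integral_of_le zero_le_one]
    refine integral_integral_swap ?_
    rw [Measure.prod_restrict]
    refine IntegrableOn.mono_set (t := Set.Icc (0 : ι → ℝ) 1 ×ˢ Set.Icc (0 : ℝ) 1) ?_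
      (Set.prod_mono subset_rfl Set.Ioc_subset_Icc_self)
    refine ContinuousOn.integrableOn_compact (isCompact_Icc.prod isCompact_Icc) ?_
    exact (hc'.comp (continuous_fst.add (continuous_snd.smul continuous_const))).continuousOn
  have hconst : ∀ t : ℝ, ∫ y in Set.Icc (0 : ι → ℝ) 1, fderiv ℝ f (y + t • v) v
      = ∫ y in Set.Icc 0 1, fderiv ℝ f y v := fun t =>
    integral_cell_translate (f := fun y => fderiv ℝ f y v) hper (t • v)
  simp only [hloop, hconst] at hswap
  simpa using hswap.symm

/-- Integration by parts against a Fourier mode. -/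
theorem integral_mode_mul_fderiv [DecidableEq ι] {f : (ι → ℝ) → ℂ} (hc : ContDiff ℝ 1 f)
    (hf : ∀ (z : ι → ℤ) (y : ι → ℝ), f (fun p => y p + (z p : ℝ)) = f y) (p : ι) (k : ι → ℤ) :
    ∫ y in Set.Icc 0 1, mode (-k) y * fderiv ℝ f y (Pi.single p 1)
      = 2 * Real.pi * Complex.I * (k p : ℂ) * ∫ y in Set.Icc 0 1, mode (-k) y * f y := by
  have hm : ContDiff ℝ 1 (mode (-k)) := (contDiff_mode (-k)).of_le (by exact_mod_cast le_top)
  have h0 := integral_fderiv_eq_zero (f := fun y => mode (-k) y * f y) (hm.mul hc)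
    (fun z y => by rw [mode_periodic, hf]) p
  have h1 : ∀ y, fderiv ℝ (fun y => mode (-k) y * f y) y (Pi.single p 1)
      = mode (-k) y * fderiv ℝ f y (Pi.single p 1)
        - 2 * Real.pi * Complex.I * (k p : ℂ) * (mode (-k) y * f y) := by
    intro y
    have : HasFDerivAt (fun y => mode (-k) y * f y) _ y :=
      (hasFDerivAt_mode (-k) y).mul ((hc.differentiable one_ne_zero) y).hasFDerivAt
    rw [this.fderiv]
    simp only [_root_.add_apply, _root_.smul_apply, modeLin_single, smul_eq_mul,
      Pi.neg_apply, Int.cast_neg]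
    ring
  simp only [h1] at h0
  rw [integral_sub, integral_const_mul, sub_eq_zero] at h0
  · exact h0
  · exact integrableOn_cell ((continuous_mode _).mul
      ((hc.continuous_fderiv one_ne_zero).clm_apply continuous_const))
  · exact (integrableOn_cell ((continuous_mode _).mul hc.continuous)).const_mul _

theorem volume_cell : volume (Set.Icc (0 : ι → ℝ) 1) = 1 := by
  simp [Real.volume_Icc_pi]

theorem integral_mode (k : ι → ℤ) :
    ∫ y in Set.Icc (0 : ι → ℝ) 1, mode k y = if k = 0 then 1 else 0 := by
  classical
  split_ifs with hk
  · subst hk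
    simp [mode_zero, Measure.real, volume_cell]
  · obtain ⟨p, hp⟩ := Function.ne_iff.1 hk
    have h := integral_fderiv_eq_zero ((contDiff_mode k).of_le (by exact_mod_cast le_top))
      (mode_periodic k) p
    simp only [(hasFDerivAt_mode k _).fderiv, _root_.smul_apply, modeLin_single, smul_eq_mul] at h
    rw [integral_mul_const, mul_eq_zero] at h
    refine h.resolve_right ?_
    have : (k p : ℂ) ≠ 0 := by exact_mod_cast hp
    simp [this, Real.pi_ne_zero]

/-- The Fourier coefficients of a Fourier series are the ones it is built from. -/
theorem integral_mode_mul_fourierSum {a : (ι → ℤ) → ℂ} (ha : ExpDecay a) (k : ι → ℤ) :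
    ∫ y in Set.Icc (0 : ι → ℝ) 1, mode (-k) y * fourierSum a y = a k := by
  have h1 : ∀ y, mode (-k) y * fourierSum a y = ∑' l, a l * mode (l - k) y := by
    intro y
    rw [fourierSum, ← tsum_mul_left]
    refine tsum_congr fun l => ?_
    rw [sub_eq_add_neg, mode_add]
    ring
  simp only [h1]
  have h2 := hasSum_integral_of_summable_integral_norm (μ := volume.restrict (Set.Icc (0 : ι → ℝ) 1))
    (F := fun l y => a l * mode (l - k) y)
    (fun l => integrableOn_cell (continuous_const.mul (continuous_mode _)))
    (by simpa [norm_mode, Measure.real, volume_cell] using ha.summable)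
  rw [← h2.tsum_eq]
  simp only [integral_const_mul, integral_mode, sub_eq_zero, mul_ite, mul_one, mul_zero]
  exact tsum_ite_eq k fun l => a l

/-- A continuous periodic function with exponentially decaying Fourier coefficients is the sum of
its Fourier series. -/
theorem eq_fourierSum {f : (ι → ℝ) → ℂ} (hc : Continuous f)
    (hf : ∀ (z : ι → ℤ) (y : ι → ℝ), f (fun p => y p + (z p : ℝ)) = f y) {a : (ι → ℤ) → ℂ}
    (ha : ExpDecay a) (h : ∀ k : ι → ℤ, ∫ y in Set.Icc 0 1, mode (-k) y * f y = a k)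
    (y : ι → ℝ) : f y = fourierSum a y := by
  rw [← sub_eq_zero]
  refine eq_zero_of_coeff_eq_zero (f := fun y => f y - fourierSum a y)
    (hc.sub (continuous_fourierSum ha)) (fun z y => by rw [hf, fourierSum_periodic])
    (fun k => ?_) y
  have h1 := h (-k)
  have h2 := integral_mode_mul_fourierSum ha (-k)
  rw [neg_neg] at h1 h2
  simp only [mul_sub]
  have h3 : IntegrableOn (fun y => mode k y * f y) (Set.Icc 0 1) :=
    integrableOn_cell ((continuous_mode k).mul hc)
  have h4 : IntegrableOn (fun y => mode k y * fourierSum a y) (Set.Icc 0 1) :=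
    integrableOn_cell ((continuous_mode k).mul (continuous_fourierSum ha))
  rw [integral_sub h3 h4, h1, h2, sub_self]

end Cell

/-! ### Fourier coefficients of real analytic functions -/

section Analytic

variable {ι : Type*} [Fintype ι]

/-- The Fourier coefficients of a real-valued periodic function. -/
def realCoeff (g : (ι → ℝ) → ℝ) (k : ι → ℤ) : ℂ :=
  ∫ y in Set.Icc (0 : ι → ℝ) 1, mode (-k) y * (g y : ℂ)

theorem norm_realCoeff_le {g : (ι → ℝ) → ℝ} {M : ℝ} (hM : ∀ y, |g y| ≤ M) (k : ι → ℤ) :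
    ‖realCoeff g k‖ ≤ M := by
  have h := norm_setIntegral_le_of_norm_le_const (μ := volume) (s := Set.Icc (0 : ι → ℝ) 1)
    (f := fun y => mode (-k) y * (g y : ℂ)) (C := M) (by simp [volume_cell])
    (fun y _ => by rw [norm_mul, norm_mode, one_mul, Complex.norm_real]; exact hM y)
  rw [Measure.real, volume_cell, ENNReal.toReal_one, mul_one] at h
  exact h

theorem realCoeff_fderiv [DecidableEq ι] {g : (ι → ℝ) → ℝ} (hg : ContDiff ℝ 1 g)
    (hper : ∀ (z : ι → ℤ) (y : ι → ℝ), g (fun p => y p + (z p : ℝ)) = g y) (p : ι) (k : ι → ℤ) :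
    realCoeff (fun y => fderiv ℝ g y (Pi.single p 1)) k
      = 2 * Real.pi * Complex.I * (k p : ℂ) * realCoeff g k := by
  have hc : ContDiff ℝ 1 fun y => (g y : ℂ) := Complex.ofRealCLM.contDiff.comp hg
  have h := integral_mode_mul_fderiv hc (fun z y => by rw [hper]) p k
  rw [realCoeff, realCoeff, ← h]
  congr 1
  funext y
  have h2 : HasFDerivAt (fun y => (g y : ℂ)) (Complex.ofRealCLM.comp (fderiv ℝ g y)) y :=
    Complex.ofRealCLM.hasFDerivAt.comp y ((hg.differentiable one_ne_zero) y).hasFDerivAt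
  rw [h2.fderiv]
  rfl

theorem realCoeff_iteratedFDeriv [DecidableEq ι] {g : (ι → ℝ) → ℝ} (hg : ContDiff ℝ ∞ g)
    (hper : ∀ (z : ι → ℤ) (y : ι → ℝ), g (fun p => y p + (z p : ℝ)) = g y) (p : ι) (k : ι → ℤ)
    (l : ℕ) :
    realCoeff (fun y => iteratedFDeriv ℝ l g y fun _ => Pi.single p 1) k
      = (2 * Real.pi * Complex.I * (k p : ℂ)) ^ l * realCoeff g k := by
  induction l with
  | zero => simp
  | succ l ih =>
    have hsm : ContDiff ℝ ∞ fun y => iteratedFDeriv ℝ l g y := by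
      refine hg.iteratedFDeriv_right (i := l) ?_
      exact_mod_cast le_rfl
    have hG : ContDiff ℝ 1 fun y => iteratedFDeriv ℝ l g y fun _ => Pi.single p 1 :=
      (ContinuousMultilinearMap.apply ℝ (fun _ : Fin l => ι → ℝ) ℝ
        fun _ => Pi.single p 1).contDiff.comp (hsm.of_le (by exact_mod_cast le_top))
    have hGper : ∀ (z : ι → ℤ) (y : ι → ℝ),
        (iteratedFDeriv ℝ l g (fun q => y q + (z q : ℝ)) fun _ => Pi.single p 1)
          = iteratedFDeriv ℝ l g y fun _ => Pi.single p 1 := by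
      intro z y
      have h1 := iteratedFDeriv_comp_add_right (𝕜 := ℝ) (f := g) l (fun q => (z q : ℝ)) y
      have h2 : (fun x => g (x + fun q => (z q : ℝ))) = g := funext fun x => hper z x
      rw [h2] at h1
      rw [h1]
      rfl
    rw [pow_succ', mul_assoc, ← ih, ← realCoeff_fderiv hG hGper p k]
    congr 1
    funext y
    rw [iteratedFDeriv_succ_apply_left]
    have h3 : HasFDerivAt (fun y => iteratedFDeriv ℝ l g y fun _ => Pi.single p 1)
        ((ContinuousMultilinearMap.apply ℝ (fun _ : Fin l => ι → ℝ) ℝ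
          fun _ => Pi.single p 1).comp (fderiv ℝ (iteratedFDeriv ℝ l g) y)) y :=
      (ContinuousMultilinearMap.apply ℝ (fun _ : Fin l => ι → ℝ) ℝ
        fun _ => Pi.single p 1).hasFDerivAt.comp y
        ((hsm.differentiable (by simp)) y).hasFDerivAt
    rw [h3.fderiv]
    rfl

theorem mul_exp_le_of_pow_le {c x C Λ : ℝ} (hΛ : 0 < Λ)
    (h : ∀ l : ℕ, c * x ^ l ≤ C * Λ ^ l * (l ! : ℝ)) :
    c * Real.exp (x / (2 * Λ)) ≤ 2 * C := by
  have h1 : HasSum (fun l : ℕ => c * ((x / (2 * Λ)) ^ l / (l ! : ℝ)))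
      (c * Real.exp (x / (2 * Λ))) := by
    rw [Real.exp_eq_exp_ℝ]
    exact (NormedSpace.expSeries_div_hasSum_exp (x / (2 * Λ))).mul_left c
  have h2 : HasSum (fun l : ℕ => C * (1 / 2 : ℝ) ^ l) (2 * C) := by
    have := hasSum_geometric_two.mul_left C
    rwa [mul_comm C 2] at this
  refine hasSum_le (fun l => ?_) h1 h2
  have h3 : (0 : ℝ) < (l ! : ℝ) := by exact_mod_cast Nat.factorial_pos l
  have h4 : c * ((x / (2 * Λ)) ^ l / (l ! : ℝ)) = c * x ^ l * ((1 / 2) ^ l / (Λ ^ l * (l ! : ℝ))) := by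
    rw [div_pow, mul_pow, one_div, inv_pow]
    field_simp
  rw [h4]
  calc c * x ^ l * ((1 / 2) ^ l / (Λ ^ l * (l ! : ℝ)))
      ≤ C * Λ ^ l * (l ! : ℝ) * ((1 / 2) ^ l / (Λ ^ l * (l ! : ℝ))) := by
        exact mul_le_mul_of_nonneg_right (h l) (by positivity)
    _ = C * (1 / 2) ^ l := by field_simp

/-- Real analyticity with constants `C`, `Λ` gives exponential decay of the Fourier coefficients at
a rate depending only on `Λ` and the dimension. -/
theorem norm_realCoeff_le_exp [DecidableEq ι] [Nonempty ι] {g : (ι → ℝ) → ℝ}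
    (hg : ContDiff ℝ ∞ g)
    (hper : ∀ (z : ι → ℤ) (y : ι → ℝ), g (fun p => y p + (z p : ℝ)) = g y) {C Λ : ℝ}
    (hΛ : 0 < Λ)
    (han : ∀ (l : ℕ) (y : ι → ℝ) (p : ι),
      |iteratedFDeriv ℝ l g y fun _ => Pi.single p 1| ≤ C * Λ ^ l * (l ! : ℝ)) (k : ι → ℤ) :
    ‖realCoeff g k‖ ≤ 2 * C * Real.exp (-(Real.pi / (Λ * Fintype.card ι)) * modeSize k) := by
  obtain ⟨p, -, hp⟩ := Finset.exists_max_image Finset.univ (fun p => |(k p : ℝ)|)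
    Finset.univ_nonempty
  have hN : (0 : ℝ) < Fintype.card ι := by exact_mod_cast Fintype.card_pos
  have h1 : modeSize k ≤ Fintype.card ι * |(k p : ℝ)| := by
    refine (Finset.sum_le_card_nsmul _ _ _ hp).trans (le_of_eq ?_)
    simp
  have h2 : ∀ l : ℕ, ‖realCoeff g k‖ * (2 * Real.pi * |(k p : ℝ)|) ^ l
      ≤ C * Λ ^ l * (l ! : ℝ) := by
    intro l
    have h3 := norm_realCoeff_le (fun y => han l y p) k
    rw [realCoeff_iteratedFDeriv hg hper, norm_mul, norm_pow] at h3
    have h4 : ‖2 * Real.pi * Complex.I * (k p : ℂ)‖ = 2 * Real.pi * |(k p : ℝ)| := by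
      simp [abs_of_pos Real.pi_pos]
    rwa [h4, mul_comm] at h3
  have h5 := mul_exp_le_of_pow_le hΛ h2
  have h6 : Real.exp (Real.pi / (Λ * Fintype.card ι) * modeSize k)
      ≤ Real.exp (2 * Real.pi * |(k p : ℝ)| / (2 * Λ)) := by
    apply Real.exp_le_exp.2
    calc Real.pi / (Λ * Fintype.card ι) * modeSize k
        ≤ Real.pi / (Λ * Fintype.card ι) * (Fintype.card ι * |(k p : ℝ)|) := by
          have := Real.pi_pos
          gcongr
      _ = 2 * Real.pi * |(k p : ℝ)| / (2 * Λ) := by field_simp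
  rw [neg_mul, Real.exp_neg, ← div_eq_mul_inv, le_div_iff₀ (Real.exp_pos _)]
  exact (mul_le_mul_of_nonneg_left h6 (norm_nonneg _)).trans h5

theorem realCoeff_zero (g : (ι → ℝ) → ℝ) :
    realCoeff g 0 = ((∫ y in Set.Icc (0 : ι → ℝ) 1, g y : ℝ) : ℂ) := by
  simp only [realCoeff, neg_zero, mode_zero, one_mul]
  exact integral_ofReal

theorem eq_fourierSum_realCoeff {g : (ι → ℝ) → ℝ} (hg : Continuous g)
    (hper : ∀ (z : ι → ℤ) (y : ι → ℝ), g (fun p => y p + (z p : ℝ)) = g y)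
    (ha : ExpDecay (realCoeff g)) (y : ι → ℝ) : (g y : ℂ) = fourierSum (realCoeff g) y :=
  eq_fourierSum (f := fun y => (g y : ℂ)) (Complex.continuous_ofReal.comp hg)
    (fun z y => by rw [hper]) ha (fun _ => rfl) y

end Analytic

/-! ### Weighted energy estimates for Galerkin approximations -/

section Galerkin

variable {ι β : Type*} [Fintype ι] [Fintype β]

/-- The quadratic form `∫ z̄ · A z` on trigonometric polynomials, written in terms of the Fourier
coefficients `α` of `A`, is coercive with constant `lam`. -/
def IsCoerciveSymbol (lam : ℝ) (α : β → β → (ι → ℤ) → ℂ) : Prop :=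
  ∀ (S : Finset (ι → ℤ)) (z : (ι → ℤ) → β → ℂ),
    lam * ∑ k ∈ S, ∑ a, ‖z k a‖ ^ 2
      ≤ (∑ k ∈ S, ∑ l ∈ S, ∑ a, ∑ b, (starRingEnd ℂ) (z k a) * α a b (k - l) * z l b).re

/-- The matrix entry of `-∇̂ · A ∇̂` between the modes `k` and `l`, when `∇̂` acts as `i κ`. -/
def symbolEntry (α : β → β → (ι → ℤ) → ℂ) (κ : (ι → ℤ) → β → ℝ) (k l : ι → ℤ) : ℂ :=
  ∑ a, ∑ b, (κ k a : ℂ) * α a b (k - l) * (κ l b : ℂ)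

/-- Schur's test for the convolution kernel `exp (-ρ |k - l|)`. -/
theorem schur_exp {ρ : ℝ} (hρ : 0 < ρ) (S : Finset (ι → ℤ)) (P : (ι → ℤ) → ℝ) :
    ∑ k ∈ S, ∑ l ∈ S, Real.exp (-ρ * modeSize (k - l)) * (P k * P l)
      ≤ (∑' m : ι → ℤ, Real.exp (-ρ * modeSize m)) * ∑ k ∈ S, P k ^ 2 := by
  set T := ∑' m : ι → ℤ, Real.exp (-ρ * modeSize m)
  have hrow : ∀ k, ∑ l ∈ S, Real.exp (-ρ * modeSize (k - l)) ≤ T := fun k => by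
    refine le_trans ?_ (tsum_exp_modeSize_sub ρ k).le
    exact (summable_exp_modeSize_sub hρ k).sum_le_tsum _ fun _ _ => (Real.exp_pos _).le
  have h1 : ∑ k ∈ S, ∑ l ∈ S, Real.exp (-ρ * modeSize (k - l)) * P k ^ 2
      ≤ T * ∑ k ∈ S, P k ^ 2 := by
    rw [Finset.mul_sum]
    refine Finset.sum_le_sum fun k _ => ?_
    rw [← Finset.sum_mul]
    exact mul_le_mul_of_nonneg_right (hrow k) (sq_nonneg _)
  have h2 : ∑ k ∈ S, ∑ l ∈ S, Real.exp (-ρ * modeSize (k - l)) * P l ^ 2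
      = ∑ k ∈ S, ∑ l ∈ S, Real.exp (-ρ * modeSize (k - l)) * P k ^ 2 := by
    rw [Finset.sum_comm]
    refine Finset.sum_congr rfl fun k _ => Finset.sum_congr rfl fun l _ => ?_
    rw [← modeSize_neg (l - k), neg_sub]
  have h3 : ∑ k ∈ S, ∑ l ∈ S, Real.exp (-ρ * modeSize (k - l)) * (P k * P l)
      ≤ ∑ k ∈ S, ∑ l ∈ S, (Real.exp (-ρ * modeSize (k - l)) * P k ^ 2
        + Real.exp (-ρ * modeSize (k - l)) * P l ^ 2) / 2 := by
    refine Finset.sum_le_sum fun k _ => Finset.sum_le_sum fun l _ => ?_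
    have := Real.exp_pos (-ρ * modeSize (k - l))
    nlinarith [mul_nonneg this.le (sq_nonneg (P k - P l))]
  simp only [← Finset.sum_div, Finset.sum_add_distrib, h2] at h3
  linarith

theorem abs_exp_sub_one_le {s t : ℝ} (h : |s| ≤ t) : |Real.exp s - 1| ≤ Real.exp t - 1 := by
  have h1 : Real.exp s ≤ Real.exp t := Real.exp_le_exp.2 ((le_abs_self s).trans h)
  rw [abs_le]
  refine ⟨?_, by linarith⟩
  have h2 : 1 + -t ≤ Real.exp s := by
    have := Real.add_one_le_exp s
    linarith [(abs_le.1 h).1]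
  linarith [Real.add_one_le_exp t]

theorem exp_mul_sub_one_le {θ x : ℝ} (h0 : 0 ≤ θ) (h1 : θ ≤ 1) :
    Real.exp (θ * x) - 1 ≤ θ * Real.exp x := by
  have := convexOn_exp.2 (Set.mem_univ x) (Set.mem_univ (0 : ℝ)) h0
    (sub_nonneg.2 h1) (by ring)
  simp only [smul_eq_mul, mul_zero, add_zero, Real.exp_zero, mul_one] at this
  linarith

theorem abs_modeSize_sub_le (k l : ι → ℤ) : |modeSize k - modeSize l| ≤ modeSize (k - l) := by
  have h1 := modeSize_add_le (k - l) l
  have h2 := modeSize_add_le (l - k) k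
  rw [sub_add_cancel] at h1 h2
  rw [← modeSize_neg (l - k), neg_sub] at h2
  rw [abs_le]
  constructor <;> linarith

/-- Coercivity survives the conjugation by the weights `exp (θσ|k|)` if `θ` is small: the weights
have Lipschitz logarithm, so the commutator with the exponentially decaying symbol is small. -/
theorem weighted_coercive {lam Ca σ θ : ℝ} {α : β → β → (ι → ℤ) → ℂ}
    (hco : IsCoerciveSymbol lam α) (hCa : 0 ≤ Ca) (hσ : 0 < σ)
    (hα : ∀ a b m, ‖α a b m‖ ≤ Ca * Real.exp (-(2 * σ) * modeSize m))
    (hθ0 : 0 ≤ θ) (hθ1 : θ ≤ 1)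
    (hθ : θ * (Fintype.card β * Ca * ∑' m : ι → ℤ, Real.exp (-σ * modeSize m)) ≤ lam / 2)
    (S : Finset (ι → ℤ)) (z : (ι → ℤ) → β → ℂ) :
    lam / 2 * ∑ k ∈ S, ∑ a, ‖z k a‖ ^ 2
      ≤ (∑ k ∈ S, ∑ l ∈ S, ∑ a, ∑ b, (starRingEnd ℂ) (z k a)
          * ((Real.exp (θ * σ * (modeSize k - modeSize l)) : ℝ) * α a b (k - l)) * z l b).re := by
  set T := ∑' m : ι → ℤ, Real.exp (-σ * modeSize m) with hT
  have hentry : ∀ (k l : ι → ℤ) (a b : β),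
      ‖((Real.exp (θ * σ * (modeSize k - modeSize l)) : ℝ) : ℂ) * α a b (k - l) - α a b (k - l)‖
        ≤ θ * Ca * Real.exp (-σ * modeSize (k - l)) := by
    intro k l a b
    have h1 : |Real.exp (θ * σ * (modeSize k - modeSize l)) - 1|
        ≤ θ * Real.exp (σ * modeSize (k - l)) := by
      refine (abs_exp_sub_one_le (t := θ * (σ * modeSize (k - l))) ?_).trans
        (exp_mul_sub_one_le hθ0 hθ1)
      rw [abs_mul, abs_of_nonneg (by positivity), mul_assoc]
      gcongr
      exact abs_modeSize_sub_le k l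
    rw [← sub_one_mul, norm_mul, ← Complex.ofReal_one, ← Complex.ofReal_sub, Complex.norm_real,
      Real.norm_eq_abs]
    calc _ ≤ θ * Real.exp (σ * modeSize (k - l)) * (Ca * Real.exp (-(2 * σ) * modeSize (k - l))) :=
          mul_le_mul h1 (hα a b _) (norm_nonneg _) (by positivity)
      _ = θ * Ca * (Real.exp (σ * modeSize (k - l)) * Real.exp (-(2 * σ) * modeSize (k - l))) := by
          ring
      _ = _ := by
          rw [← Real.exp_add]
          congr 2
          ring
  set Q1 := ∑ k ∈ S, ∑ l ∈ S, ∑ a, ∑ b, (starRingEnd ℂ) (z k a) * α a b (k - l) * z l b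
  set Q2 := ∑ k ∈ S, ∑ l ∈ S, ∑ a, ∑ b, (starRingEnd ℂ) (z k a)
          * ((Real.exp (θ * σ * (modeSize k - modeSize l)) : ℝ) * α a b (k - l)) * z l b
  have hdiff : ‖Q2 - Q1‖ ≤ θ * Ca * ∑ k ∈ S, ∑ l ∈ S,
      Real.exp (-σ * modeSize (k - l)) * ((∑ a, ‖z k a‖) * ∑ a, ‖z l a‖) := by
    simp only [Q1, Q2, ← Finset.sum_sub_distrib, Finset.mul_sum (s := S)]
    refine norm_sum_le_of_le _ fun k _ => norm_sum_le_of_le _ fun l _ => ?_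
    rw [Finset.sum_mul_sum, Finset.mul_sum, Finset.mul_sum]
    refine norm_sum_le_of_le _ fun a _ => ?_
    rw [Finset.mul_sum, Finset.mul_sum]
    refine norm_sum_le_of_le _ fun b _ => ?_
    rw [← sub_mul, ← mul_sub, norm_mul, norm_mul, RCLike.norm_conj]
    calc _ ≤ ‖z k a‖ * (θ * Ca * Real.exp (-σ * modeSize (k - l))) * ‖z l b‖ := by
          gcongr
          exact hentry k l a b
      _ = _ := by ring
  have hP : ∑ k ∈ S, (∑ a, ‖z k a‖) ^ 2 ≤ Fintype.card β * ∑ k ∈ S, ∑ a, ‖z k a‖ ^ 2 := by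
    rw [Finset.mul_sum]
    refine Finset.sum_le_sum fun k _ => ?_
    simpa using sq_sum_le_card_mul_sum_sq (s := Finset.univ) (f := fun a => ‖z k a‖)
  have hT0 : 0 ≤ T := tsum_nonneg fun _ => (Real.exp_pos _).le
  have hbound : ‖Q2 - Q1‖ ≤ lam / 2 * ∑ k ∈ S, ∑ a, ‖z k a‖ ^ 2 := by
    calc ‖Q2 - Q1‖ ≤ _ := hdiff
      _ ≤ θ * Ca * (T * ∑ k ∈ S, (∑ a, ‖z k a‖) ^ 2) := by
          gcongr
          exact schur_exp hσ S fun k => ∑ a, ‖z k a‖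
      _ ≤ θ * Ca * (T * (Fintype.card β * ∑ k ∈ S, ∑ a, ‖z k a‖ ^ 2)) := by gcongr
      _ = θ * (Fintype.card β * Ca * T) * ∑ k ∈ S, ∑ a, ‖z k a‖ ^ 2 := by ring
      _ ≤ _ := by
          gcongr
  have h1 := hco S z
  have h2 : |(Q2 - Q1).re| ≤ ‖Q2 - Q1‖ := Complex.abs_re_le_norm _
  rw [Complex.sub_re] at h2
  have h3 := (abs_le.1 h2).1
  change _ ≤ Q1.re at h1
  linarith

/-- The energy estimate for a Galerkin approximation, with exponential weights. -/
theorem weighted_energy {lam Ca σ θ τ B : ℝ} {α : β → β → (ι → ℤ) → ℂ} (hlam : 0 < lam)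
    (hco : IsCoerciveSymbol lam α) (hCa : 0 ≤ Ca) (hσ : 0 < σ)
    (hα : ∀ a b m, ‖α a b m‖ ≤ Ca * Real.exp (-(2 * σ) * modeSize m))
    (hθ0 : 0 ≤ θ) (hθ1 : θ ≤ 1)
    (hθ : θ * (Fintype.card β * Ca * ∑' m : ι → ℤ, Real.exp (-σ * modeSize m)) ≤ lam / 2)
    (κ : (ι → ℤ) → β → ℝ) (S : Finset (ι → ℤ)) (x : (ι → ℤ) → ℂ) (f : (ι → ℤ) → β → ℂ)
    (hB : ∑ k ∈ S, ∑ a, (Real.exp (θ * σ * modeSize k) * ‖f k a‖) ^ 2 ≤ B)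
    (hx : ∀ k ∈ S, ∑ l ∈ S, symbolEntry α κ k l * x l + (τ : ℂ) ^ 2 * x k
      = Complex.I * ∑ a, (κ k a : ℂ) * f k a) :
    lam / 4 * (∑ k ∈ S, ∑ a, (|κ k a| * Real.exp (θ * σ * modeSize k) * ‖x k‖) ^ 2)
      + τ ^ 2 * ∑ k ∈ S, (Real.exp (θ * σ * modeSize k) * ‖x k‖) ^ 2 ≤ B / lam := by
  set w : (ι → ℤ) → ℝ := fun k => Real.exp (θ * σ * modeSize k) with hw
  have hw0 : ∀ k, 0 < w k := fun k => Real.exp_pos _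
  set z : (ι → ℤ) → β → ℂ := fun k a => (κ k a : ℂ) * w k * x k with hz
  have hzn : ∀ k a, ‖z k a‖ = |κ k a| * w k * ‖x k‖ := by
    intro k a
    simp [hz, abs_of_pos (hw0 k)]
  -- Test the equation of the mode `k` with `w k ^ 2 * x k`.
  have hcoer := weighted_coercive hco hCa hσ hα hθ0 hθ1 hθ S z
  have hrow : ∀ k ∈ S, (∑ l ∈ S, ∑ a, ∑ b, (starRingEnd ℂ) (z k a)
        * ((Real.exp (θ * σ * (modeSize k - modeSize l)) : ℝ) * α a b (k - l)) * z l b)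
      + (τ : ℂ) ^ 2 * ((w k * ‖x k‖) ^ 2 : ℝ)
      = ∑ a, Complex.I * ((starRingEnd ℂ) (z k a) * (w k * f k a)) := by
    intro k hk
    have h1 := congrArg (fun u => (starRingEnd ℂ) (x k) * (w k : ℂ) ^ 2 * u) (hx k hk)
    simp only [mul_add, Finset.mul_sum] at h1
    have h2 : ∀ l, (starRingEnd ℂ) (x k) * (w k : ℂ) ^ 2 * (symbolEntry α κ k l * x l)
        = ∑ a, ∑ b, (starRingEnd ℂ) (z k a)
        * ((Real.exp (θ * σ * (modeSize k - modeSize l)) : ℝ) * α a b (k - l)) * z l b := by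
      intro l
      have hwl : (w k : ℂ) = (Real.exp (θ * σ * (modeSize k - modeSize l)) : ℝ) * (w l : ℂ) := by
        have h : w k = Real.exp (θ * σ * (modeSize k - modeSize l)) * w l := by
          simp only [hw, ← Real.exp_add]
          congr 1
          ring
        rw [← Complex.ofReal_mul, ← h]
      simp only [symbolEntry, Finset.sum_mul, Finset.mul_sum]
      refine Finset.sum_congr rfl fun a _ => Finset.sum_congr rfl fun b _ => ?_
      simp only [hz, map_mul, Complex.conj_ofReal]
      linear_combination ((starRingEnd ℂ) (x k) * (w k : ℂ) * (κ k a : ℂ) * α a b (k - l)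
        * (κ l b : ℂ) * x l) * hwl
    simp only [h2] at h1
    have h3 : (starRingEnd ℂ) (x k) * (w k : ℂ) ^ 2 * ((τ : ℂ) ^ 2 * x k)
        = (τ : ℂ) ^ 2 * ((w k * ‖x k‖) ^ 2 : ℝ) := by
      have : (starRingEnd ℂ) (x k) * x k = (‖x k‖ : ℂ) ^ 2 := Complex.conj_mul' (x k)
      push_cast
      rw [mul_pow, ← this]
      ring
    rw [h3] at h1
    rw [h1]
    refine Finset.sum_congr rfl fun a _ => ?_
    simp only [hz, map_mul, Complex.conj_ofReal]
    ring
  have hsum := Finset.sum_congr rfl hrow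
  rw [Finset.sum_add_distrib] at hsum
  have hre := congrArg Complex.re hsum
  rw [Complex.add_re] at hre
  have hτ : (∑ k ∈ S, (τ : ℂ) ^ 2 * ((w k * ‖x k‖) ^ 2 : ℝ)).re
      = τ ^ 2 * ∑ k ∈ S, (w k * ‖x k‖) ^ 2 := by
    rw [Finset.mul_sum, Complex.re_sum]
    refine Finset.sum_congr rfl fun k _ => ?_
    rw [← Complex.ofReal_pow, ← Complex.ofReal_mul, Complex.ofReal_re]
  rw [hτ] at hre
  have hrhs : (∑ k ∈ S, ∑ a, Complex.I * ((starRingEnd ℂ) (z k a) * (w k * f k a))).re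
      ≤ ∑ k ∈ S, ∑ a, (lam / 4 * ‖z k a‖ ^ 2 + (w k * ‖f k a‖) ^ 2 / lam) := by
    refine (Complex.re_le_norm _).trans ?_
    refine norm_sum_le_of_le _ fun k _ => norm_sum_le_of_le _ fun a _ => ?_
    have hfn : ‖(w k : ℂ) * f k a‖ = w k * ‖f k a‖ := by
      rw [norm_mul, Complex.norm_real, Real.norm_of_nonneg (hw0 k).le]
    rw [norm_mul, Complex.norm_I, one_mul, norm_mul, RCLike.norm_conj, hfn]
    have h4 : lam / 4 * ‖z k a‖ ^ 2 + (w k * ‖f k a‖) ^ 2 / lam - ‖z k a‖ * (w k * ‖f k a‖)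
        = (lam * ‖z k a‖ / 2 - w k * ‖f k a‖) ^ 2 / lam := by
      field_simp
      ring
    have h5 : 0 ≤ (lam * ‖z k a‖ / 2 - w k * ‖f k a‖) ^ 2 / lam := by positivity
    linarith
  have hsplit : ∑ k ∈ S, ∑ a, (lam / 4 * ‖z k a‖ ^ 2 + (w k * ‖f k a‖) ^ 2 / lam)
      = lam / 4 * ∑ k ∈ S, ∑ a, ‖z k a‖ ^ 2 + (∑ k ∈ S, ∑ a, (w k * ‖f k a‖) ^ 2) / lam := by
    simp only [Finset.sum_add_distrib, ← Finset.mul_sum, ← Finset.sum_div]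
  rw [hsplit] at hrhs
  have hB' : (∑ k ∈ S, ∑ a, (w k * ‖f k a‖) ^ 2) / lam ≤ B / lam := by
    gcongr
  have hgoal : ∑ k ∈ S, ∑ a, (|κ k a| * Real.exp (θ * σ * modeSize k) * ‖x k‖) ^ 2
      = ∑ k ∈ S, ∑ a, ‖z k a‖ ^ 2 := by
    simp only [hzn, hw]
  rw [hgoal]
  linarith

/-- The Galerkin system on a finite set of modes is solvable: it is a square system, injective by
the energy estimate. -/
theorem exists_galerkin {lam Ca σ τ : ℝ} {α : β → β → (ι → ℤ) → ℂ} (hlam : 0 < lam)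
    (hco : IsCoerciveSymbol lam α) (hCa : 0 ≤ Ca) (hσ : 0 < σ)
    (hα : ∀ a b m, ‖α a b m‖ ≤ Ca * Real.exp (-(2 * σ) * modeSize m)) (hτ : 0 < τ)
    (κ : (ι → ℤ) → β → ℝ) (S : Finset (ι → ℤ)) (g : (ι → ℤ) → ℂ) :
    ∃ x : (ι → ℤ) → ℂ, (∀ k ∉ S, x k = 0) ∧
      ∀ k ∈ S, ∑ l ∈ S, symbolEntry α κ k l * x l + (τ : ℂ) ^ 2 * x k = g k := by
  classical
  let ext : (S → ℂ) → (ι → ℤ) → ℂ := fun x k => if h : k ∈ S then x ⟨k, h⟩ else 0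
  have hext : ∀ (x : S → ℂ) (k : S), ext x k = x k := fun x k => by simp [ext]
  let L : (S → ℂ) →ₗ[ℂ] (S → ℂ) :=
    (Matrix.of fun k l : S => symbolEntry α κ k l).mulVecLin + ((τ : ℂ) ^ 2) • LinearMap.id
  have hL : ∀ (x : S → ℂ) (k : S),
      L x k = ∑ l ∈ S, symbolEntry α κ k l * ext x l + (τ : ℂ) ^ 2 * ext x k := by
    intro x k
    rw [hext, ← Finset.sum_coe_sort S]
    simp only [hext]
    rfl
  have hinj : Function.Injective L := by
    rw [injective_iff_map_eq_zero]
    intro x hx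
    have h0 := weighted_energy (θ := 0) (τ := τ) (B := 0) hlam hco hCa hσ hα le_rfl zero_le_one
      (by rw [zero_mul]; positivity) κ S (ext x) (fun _ _ => 0) (by simp) (by
        intro k hk
        have h1 := hL x ⟨k, hk⟩
        rw [hx] at h1
        simpa using h1.symm)
    simp only [zero_mul, Real.exp_zero, mul_one, one_mul, zero_div] at h0
    have h2 : 0 ≤ lam / 4 * ∑ k ∈ S, ∑ a, (|κ k a| * ‖ext x k‖) ^ 2 := by positivity
    have h3 : ∑ k ∈ S, ‖ext x k‖ ^ 2 ≤ 0 := by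
      have h4 : τ ^ 2 * ∑ k ∈ S, ‖ext x k‖ ^ 2 ≤ 0 := by linarith
      exact nonpos_of_mul_nonpos_right h4 (by positivity)
    have h5 := (Finset.sum_eq_zero_iff_of_nonneg fun k _ => sq_nonneg ‖ext x k‖).1
      (le_antisymm h3 (Finset.sum_nonneg fun k _ => sq_nonneg _))
    funext k
    have h6 := h5 k k.2
    rw [hext] at h6
    simpa using h6
  obtain ⟨x, hx⟩ := (LinearMap.injective_iff_surjective.1 hinj) fun k => g k
  refine ⟨ext x, fun k hk => by simp [ext, hk], fun k hk => ?_⟩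
  rw [← hL x ⟨k, hk⟩, hx]

/-- Solvability of the equation on the Fourier side, with bounds independent of `τ` and `κ` for the
gradient. The solution is a limit of Galerkin approximations along an ultrafilter. -/
theorem exists_solution {lam Ca σ θ τ B : ℝ} {α : β → β → (ι → ℤ) → ℂ} (hlam : 0 < lam)
    (hco : IsCoerciveSymbol lam α) (hCa : 0 ≤ Ca) (hσ : 0 < σ)
    (hα : ∀ a b m, ‖α a b m‖ ≤ Ca * Real.exp (-(2 * σ) * modeSize m))
    (hθ0 : 0 < θ) (hθ1 : θ ≤ 1)
    (hθ : θ * (Fintype.card β * Ca * ∑' m : ι → ℤ, Real.exp (-σ * modeSize m)) ≤ lam / 2)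
    (hτ : 0 < τ) (κ : (ι → ℤ) → β → ℝ) (f : (ι → ℤ) → β → ℂ)
    (hB : ∀ S : Finset (ι → ℤ),
      ∑ k ∈ S, ∑ a, (Real.exp (θ * σ * modeSize k) * ‖f k a‖) ^ 2 ≤ B) :
    ∃ x : (ι → ℤ) → ℂ,
      (∀ k, ‖x k‖ ≤ Real.sqrt (B / lam) / τ * Real.exp (-(θ * σ) * modeSize k)) ∧
      (∀ k a, |κ k a| * ‖x k‖ ≤ 2 * Real.sqrt B / lam * Real.exp (-(θ * σ) * modeSize k)) ∧
      ∀ k, ∑' l, symbolEntry α κ k l * x l + (τ : ℂ) ^ 2 * x k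
        = Complex.I * ∑ a, (κ k a : ℂ) * f k a := by
  choose x hx0 hx using fun S => exists_galerkin hlam hco hCa hσ hα hτ κ S
    fun k => Complex.I * ∑ a, (κ k a : ℂ) * f k a
  have hB0 : 0 ≤ B := by simpa using hB ∅
  have hest := fun S => weighted_energy hlam hco hCa hσ hα hθ0.le hθ1 hθ κ S (x S) f (hB S) (hx S)
  have hexp : ∀ k : ι → ℤ, Real.exp (-(θ * σ) * modeSize k) = (Real.exp (θ * σ * modeSize k))⁻¹ :=
    fun k => by rw [← Real.exp_neg, neg_mul]
  have hb1 : ∀ S k, ‖x S k‖ ≤ Real.sqrt (B / lam) / τ * Real.exp (-(θ * σ) * modeSize k) := by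
    intro S k
    by_cases hk : k ∈ S
    · have h1 : (Real.exp (θ * σ * modeSize k) * ‖x S k‖) ^ 2
          ≤ ∑ k ∈ S, (Real.exp (θ * σ * modeSize k) * ‖x S k‖) ^ 2 :=
        Finset.single_le_sum (f := fun k => (Real.exp (θ * σ * modeSize k) * ‖x S k‖) ^ 2)
          (fun _ _ => sq_nonneg _) hk
      have h2 : (τ * (Real.exp (θ * σ * modeSize k) * ‖x S k‖)) ^ 2 ≤ B / lam := by
        rw [mul_pow]
        refine (mul_le_mul_of_nonneg_left h1 (sq_nonneg τ)).trans ?_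
        refine le_trans ?_ (hest S)
        have : 0 ≤ lam / 4
          * ∑ k ∈ S, ∑ a, (|κ k a| * Real.exp (θ * σ * modeSize k) * ‖x S k‖) ^ 2 := by positivity
        linarith
      have h3 := Real.le_sqrt_of_sq_le h2
      rw [hexp, ← div_eq_mul_inv, le_div_iff₀ (Real.exp_pos _), le_div_iff₀ hτ]
      linarith
    · rw [hx0 S k hk, norm_zero]
      positivity
  have hb2 : ∀ S k a,
      |κ k a| * ‖x S k‖ ≤ 2 * Real.sqrt B / lam * Real.exp (-(θ * σ) * modeSize k) := by
    intro S k a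
    by_cases hk : k ∈ S
    · have h0 : (|κ k a| * Real.exp (θ * σ * modeSize k) * ‖x S k‖) ^ 2
          ≤ ∑ a, (|κ k a| * Real.exp (θ * σ * modeSize k) * ‖x S k‖) ^ 2 :=
        Finset.single_le_sum
          (f := fun a => (|κ k a| * Real.exp (θ * σ * modeSize k) * ‖x S k‖) ^ 2)
          (fun _ _ => sq_nonneg _) (Finset.mem_univ a)
      have h1 : ∑ a, (|κ k a| * Real.exp (θ * σ * modeSize k) * ‖x S k‖) ^ 2
          ≤ ∑ k ∈ S, ∑ a, (|κ k a| * Real.exp (θ * σ * modeSize k) * ‖x S k‖) ^ 2 :=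
        Finset.single_le_sum
          (f := fun k => ∑ a, (|κ k a| * Real.exp (θ * σ * modeSize k) * ‖x S k‖) ^ 2)
          (fun _ _ => Finset.sum_nonneg fun _ _ => sq_nonneg _) hk
      have h2 : lam / 4 * (|κ k a| * Real.exp (θ * σ * modeSize k) * ‖x S k‖) ^ 2 ≤ B / lam := by
        refine (mul_le_mul_of_nonneg_left (h0.trans h1) (by positivity)).trans ?_
        refine le_trans ?_ (hest S)
        have : 0 ≤ τ ^ 2 * ∑ k ∈ S, (Real.exp (θ * σ * modeSize k) * ‖x S k‖) ^ 2 := by positivity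
        linarith
      have h3 : (lam / 2 * (|κ k a| * Real.exp (θ * σ * modeSize k) * ‖x S k‖)) ^ 2 ≤ B := by
        rw [le_div_iff₀ hlam] at h2
        nlinarith
      have h4 := Real.le_sqrt_of_sq_le h3
      rw [hexp, ← div_eq_mul_inv, le_div_iff₀ (Real.exp_pos _), le_div_iff₀ hlam]
      linarith
    · rw [hx0 S k hk, norm_zero, mul_zero]
      positivity
  let 𝒰 : Ultrafilter (Finset (ι → ℤ)) := Ultrafilter.of Filter.atTop
  have h𝒰 : (𝒰 : Filter (Finset (ι → ℤ))) ≤ Filter.atTop := Ultrafilter.of_le _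
  have hcpt : IsCompact (Set.univ.pi fun k : ι → ℤ => Metric.closedBall (0 : ℂ)
      (Real.sqrt (B / lam) / τ * Real.exp (-(θ * σ) * modeSize k))) :=
    isCompact_univ_pi fun k => isCompact_closedBall _ _
  obtain ⟨u, hu, hlim⟩ := hcpt.ultrafilter_le_nhds (𝒰.map x) (by
    rw [Filter.le_principal_iff, Ultrafilter.coe_map]
    refine Filter.mem_map.2 (Filter.univ_mem' fun S k _ => ?_)
    simpa using hb1 S k)
  have hlim' : ∀ k, Filter.Tendsto (fun S => x S k) 𝒰 (nhds (u k)) := by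
    have : Filter.Tendsto x 𝒰 (nhds u) := hlim
    exact tendsto_pi_nhds.1 this
  refine ⟨u, fun k => by simpa using hu k (Set.mem_univ k), fun k a => ?_, fun k => ?_⟩
  · exact le_of_tendsto ((hlim' k).norm.const_mul |κ k a|)
      (Filter.Eventually.of_forall fun S => hb2 S k a)
  · set M := 2 * Real.sqrt B / lam with hM
    have hdom : ∀ S l, ‖symbolEntry α κ k l * x S l‖
        ≤ (∑ a, ∑ _b : β, |κ k a| * Ca * M) * Real.exp (-(θ * σ) * modeSize l) := by
      intro S l
      rw [symbolEntry, Finset.sum_mul, Finset.sum_mul]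
      refine norm_sum_le_of_le _ fun a _ => ?_
      rw [Finset.sum_mul, Finset.sum_mul]
      refine norm_sum_le_of_le _ fun b _ => ?_
      have h1 : ‖α a b (k - l)‖ ≤ Ca := by
        refine (hα a b _).trans (mul_le_of_le_one_right hCa ?_)
        rw [Real.exp_le_one_iff]
        have := modeSize_nonneg (k - l)
        nlinarith
      calc ‖(κ k a : ℂ) * α a b (k - l) * (κ l b : ℂ) * x S l‖
          = |κ k a| * ‖α a b (k - l)‖ * (|κ l b| * ‖x S l‖) := by
            simp only [norm_mul, Complex.norm_real, Real.norm_eq_abs]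
            ring
        _ ≤ |κ k a| * Ca * (M * Real.exp (-(θ * σ) * modeSize l)) := by
            have := hb2 S l b
            gcongr
        _ = _ := by ring
    have ht1 : Filter.Tendsto (fun S => ∑' l, symbolEntry α κ k l * x S l) 𝒰
        (nhds (∑' l, symbolEntry α κ k l * u l)) :=
      tendsto_tsum_of_dominated_convergence
        ((summable_exp_modeSize (mul_pos hθ0 hσ)).mul_left _)
        (fun l => (hlim' l).const_mul _) (Filter.Eventually.of_forall fun S l => hdom S l)
    have ht2 := ht1.add ((hlim' k).const_mul ((τ : ℂ) ^ 2))
    refine tendsto_nhds_unique (ht2.congr' ?_) tendsto_const_nhds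
    have hmem : ∀ᶠ S in (𝒰 : Filter (Finset (ι → ℤ))), k ∈ S :=
      h𝒰 (Filter.mem_atTop_sets.2 ⟨{k}, fun S hS => Finset.singleton_subset_iff.1 hS⟩)
    filter_upwards [hmem] with S hS
    rw [← hx S k hS]
    congr 1
    exact tsum_eq_sum fun l hl => by rw [hx0 S l hl, mul_zero]

end Galerkin

/-! ### Coercivity of the Fourier symbol of an elliptic matrix -/

section Coercive

variable {ι β : Type*} [Fintype ι] [Fintype β]

theorem integral_trigPoly {g : (ι → ℝ) → ℝ} (hg : Continuous g) (S : Finset (ι → ℤ))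
    (z w : (ι → ℤ) → ℂ) :
    ∫ y in Set.Icc (0 : ι → ℝ) 1,
        (starRingEnd ℂ) (∑ k ∈ S, z k * mode k y) * (g y : ℂ) * ∑ l ∈ S, w l * mode l y
      = ∑ k ∈ S, ∑ l ∈ S, (starRingEnd ℂ) (z k) * realCoeff g (k - l) * w l := by
  have h1 : ∀ y, (starRingEnd ℂ) (∑ k ∈ S, z k * mode k y) * (g y : ℂ) * ∑ l ∈ S, w l * mode l y
      = ∑ k ∈ S, ∑ l ∈ S, (starRingEnd ℂ) (z k) * w l * (mode (-(k - l)) y * (g y : ℂ)) := by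
    intro y
    rw [map_sum, Finset.sum_mul, Finset.sum_mul]
    refine Finset.sum_congr rfl fun k _ => ?_
    rw [Finset.mul_sum]
    refine Finset.sum_congr rfl fun l _ => ?_
    rw [neg_sub, sub_eq_add_neg, mode_add, mode_neg, map_mul]
    ring
  have hint : ∀ k l : ι → ℤ, IntegrableOn
      (fun y => (starRingEnd ℂ) (z k) * w l * (mode (-(k - l)) y * (g y : ℂ))) (Set.Icc 0 1) :=
    fun k l => integrableOn_cell (continuous_const.mul
      ((continuous_mode _).mul (Complex.continuous_ofReal.comp hg)))
  simp only [h1]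
  rw [integral_finsetSum _ fun k _ => integrable_finsetSum _ fun l _ => hint k l]
  refine Finset.sum_congr rfl fun k _ => ?_
  rw [integral_finsetSum _ fun l _ => hint k l]
  refine Finset.sum_congr rfl fun l _ => ?_
  rw [integral_const_mul, realCoeff]
  ring

theorem realCoeff_one (k : ι → ℤ) : realCoeff (fun _ => (1 : ℝ)) k = if k = 0 then 1 else 0 := by
  simp [realCoeff, integral_mode]

theorem re_conj_quadratic (M : β → β → ℝ) (u : β → ℂ) :
    (∑ a, ∑ b, (starRingEnd ℂ) (u a) * (M a b : ℂ) * u b).re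
      = ∑ a, ∑ b, ((u a).re * M a b * (u b).re + (u a).im * M a b * (u b).im) := by
  simp only [Complex.re_sum]
  refine Finset.sum_congr rfl fun a _ => Finset.sum_congr rfl fun b _ => ?_
  simp only [Complex.mul_re, Complex.mul_im, Complex.conj_re, Complex.conj_im, Complex.ofReal_re,
    Complex.ofReal_im]
  ring

theorem isCoerciveSymbol_realCoeff {lam : ℝ} {A : (ι → ℝ) → β → β → ℝ}
    (hA : ∀ a b, Continuous fun y => A y a b)
    (hell : ∀ y (ξ : β → ℝ), lam * ∑ a, ξ a ^ 2 ≤ ∑ a, ∑ b, ξ a * A y a b * ξ b) :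
    IsCoerciveSymbol lam fun a b => realCoeff fun y => A y a b := by
  classical
  intro S z
  set Z : β → (ι → ℝ) → ℂ := fun a y => ∑ k ∈ S, z k a * mode k y with hZ
  have hZc : ∀ a, Continuous (Z a) := fun a =>
    continuous_finsetSum _ fun k _ => continuous_const.mul (continuous_mode k)
  have hQ : ∫ y in Set.Icc (0 : ι → ℝ) 1,
        ∑ a, ∑ b, (starRingEnd ℂ) (Z a y) * (A y a b : ℂ) * Z b y
      = ∑ k ∈ S, ∑ l ∈ S, ∑ a, ∑ b,
        (starRingEnd ℂ) (z k a) * realCoeff (fun y => A y a b) (k - l) * z l b := by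
    have hint : ∀ a b, IntegrableOn
        (fun y => (starRingEnd ℂ) (Z a y) * (A y a b : ℂ) * Z b y) (Set.Icc 0 1) := fun a b =>
      integrableOn_cell (((Complex.continuous_conj.comp (hZc a)).mul
        (Complex.continuous_ofReal.comp (hA a b))).mul (hZc b))
    rw [integral_finsetSum _ fun a _ => integrable_finsetSum _ fun b _ => hint a b]
    have h1 : ∀ a, ∫ y in Set.Icc (0 : ι → ℝ) 1,
        ∑ b, (starRingEnd ℂ) (Z a y) * (A y a b : ℂ) * Z b y
        = ∑ b, ∑ k ∈ S, ∑ l ∈ S,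
          (starRingEnd ℂ) (z k a) * realCoeff (fun y => A y a b) (k - l) * z l b := by
      intro a
      rw [integral_finsetSum _ fun b _ => hint a b]
      exact Finset.sum_congr rfl fun b _ =>
        integral_trigPoly (hA a b) S (fun k => z k a) fun l => z l b
    simp only [h1]
    simp only [Finset.sum_comm (s := (Finset.univ : Finset β)) (t := S)]
  have hN : ∫ y in Set.Icc (0 : ι → ℝ) 1, ∑ a, ‖Z a y‖ ^ 2 = ∑ k ∈ S, ∑ a, ‖z k a‖ ^ 2 := by
    have hint : ∀ a, IntegrableOn (fun y => ‖Z a y‖ ^ 2) (Set.Icc 0 1) := fun a =>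
      ((hZc a).norm.pow 2).continuousOn.integrableOn_compact isCompact_Icc
    rw [integral_finsetSum _ fun a _ => hint a, Finset.sum_comm]
    refine Finset.sum_congr rfl fun a _ => ?_
    have h1 := integral_trigPoly (continuous_const (y := (1 : ℝ))) S (fun k => z k a)
      fun k => z k a
    simp only [realCoeff_one, sub_eq_zero, mul_ite, mul_one, mul_zero, ite_mul, zero_mul,
      Finset.sum_ite_eq, Complex.ofReal_one, Complex.conj_mul'] at h1
    have h2 : ∑ k ∈ S, (if k ∈ S then (‖z k a‖ : ℂ) ^ 2 else 0) = ∑ k ∈ S, (‖z k a‖ : ℂ) ^ 2 :=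
      Finset.sum_congr rfl fun k hk => if_pos hk
    rw [h2] at h1
    have h3 : ∀ y, (‖∑ k ∈ S, z k a * mode k y‖ : ℂ) ^ 2 = ((‖Z a y‖ ^ 2 : ℝ) : ℂ) := fun y => by
      rw [Complex.ofReal_pow]
    simp only [h3] at h1
    have h4 : ∫ y in Set.Icc (0 : ι → ℝ) 1, ((‖Z a y‖ ^ 2 : ℝ) : ℂ)
        = ((∫ y in Set.Icc (0 : ι → ℝ) 1, ‖Z a y‖ ^ 2 : ℝ) : ℂ) := integral_ofReal
    have h5 := h4.symm.trans h1
    exact_mod_cast h5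
  have hpt : ∀ y, lam * ∑ a, ‖Z a y‖ ^ 2
      ≤ (∑ a, ∑ b, (starRingEnd ℂ) (Z a y) * (A y a b : ℂ) * Z b y).re := by
    intro y
    rw [re_conj_quadratic (A y) fun a => Z a y]
    have h1 := hell y fun a => (Z a y).re
    have h2 := hell y fun a => (Z a y).im
    have h3 : ∑ a, ‖Z a y‖ ^ 2 = ∑ a, (Z a y).re ^ 2 + ∑ a, (Z a y).im ^ 2 := by
      rw [← Finset.sum_add_distrib]
      refine Finset.sum_congr rfl fun a _ => ?_
      rw [← Complex.normSq_eq_norm_sq, Complex.normSq_apply]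
      ring
    simp only [Finset.sum_add_distrib]
    rw [h3, mul_add]
    exact add_le_add h1 h2
  have hQc : Continuous fun y => ∑ a, ∑ b, (starRingEnd ℂ) (Z a y) * (A y a b : ℂ) * Z b y :=
    continuous_finsetSum _ fun a _ => continuous_finsetSum _ fun b _ =>
      ((Complex.continuous_conj.comp (hZc a)).mul
        (Complex.continuous_ofReal.comp (hA a b))).mul (hZc b)
  have hNc : Continuous fun y => lam * ∑ a, ‖Z a y‖ ^ 2 :=
    continuous_const.mul (continuous_finsetSum _ fun a _ => (hZc a).norm.pow 2)
  rw [← hN, ← hQ, ← integral_const_mul]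
  have hre := integral_re (integrableOn_cell hQc).integrable
  simp only [RCLike.re_eq_complex_re] at hre
  rw [← hre]
  exact setIntegral_mono (hNc.continuousOn.integrableOn_compact isCompact_Icc)
    ((Complex.continuous_re.comp hQc).continuousOn.integrableOn_compact isCompact_Icc) hpt

end Coercive

/-! ### Real parts of Fourier series and the operator `∇̂` -/

section RealPart

variable {n d : ℕ}

/-- The real part of the Fourier series with coefficients `a`. -/
def reFourier (a : (Fin n × Fin d → ℤ) → ℂ) (y : MVar n d) : ℝ := (fourierSum a y).re

/-- The real frequency vector `κ` of a mode: `∇̂` multiplies the mode `k` by `i κ(k)`. -/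
def hatFreq (δ : Fin n → ℝ) (k : Fin n × Fin d → ℤ) (a : Fin d) : ℝ :=
  2 * Real.pi * ∑ i, (δ i)⁻¹ * (k (i, a) : ℝ)

theorem contDiff_reFourier {a : (Fin n × Fin d → ℤ) → ℂ} (ha : ExpDecay a) :
    ContDiff ℝ ∞ (reFourier a) :=
  Complex.reCLM.contDiff.comp (contDiff_fourierSum ha)

theorem reFourier_periodic (a : (Fin n × Fin d → ℤ) → ℂ) : IsTorusPeriodic (reFourier a) :=
  fun z y => by rw [reFourier, fourierSum_periodic, reFourier]

theorem abs_reFourier_le {a : (Fin n × Fin d → ℤ) → ℂ} (ha : ExpDecay a) (y : MVar n d) :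
    |reFourier a y| ≤ ∑' k, ‖a k‖ :=
  (Complex.abs_re_le_norm _).trans (norm_fourierSum_le ha y)

theorem reFourier_add {a b : (Fin n × Fin d → ℤ) → ℂ} (ha : ExpDecay a) (hb : ExpDecay b)
    (y : MVar n d) : reFourier (fun k => a k + b k) y = reFourier a y + reFourier b y := by
  rw [reFourier, fourierSum_add ha hb, Complex.add_re, reFourier, reFourier]

theorem reFourier_real_mul (c : ℝ) (a : (Fin n × Fin d → ℤ) → ℂ) (y : MVar n d) :
    reFourier (fun k => (c : ℂ) * a k) y = c * reFourier a y := by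
  rw [reFourier, fourierSum_const_mul, Complex.re_ofReal_mul, reFourier]

theorem reFourier_sum {κ : Type*} (s : Finset κ) {a : κ → (Fin n × Fin d → ℤ) → ℂ}
    (ha : ∀ i ∈ s, ExpDecay (a i)) (y : MVar n d) :
    reFourier (fun k => ∑ i ∈ s, a i k) y = ∑ i ∈ s, reFourier (a i) y := by
  rw [reFourier, fourierSum_sum s ha, Complex.re_sum]
  rfl

theorem coordD_reFourier {a : (Fin n × Fin d → ℤ) → ℂ} (ha : ExpDecay a) (p : Fin n × Fin d) :
    coordD p (reFourier a)
      = reFourier fun k => 2 * Real.pi * Complex.I * (k p : ℂ) * a k := by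
  funext y
  have h : HasFDerivAt (reFourier a) (Complex.reCLM.comp (fderiv ℝ (fourierSum a) y)) y :=
    Complex.reCLM.hasFDerivAt.comp y
      (((contDiff_fourierSum ha).differentiable (by simp)) y).hasFDerivAt
  rw [coordD, h.fderiv, ContinuousLinearMap.comp_apply, fderiv_fourierSum_single ha]
  rfl

theorem ExpDecay.hatFreq_mul {a : (Fin n × Fin d → ℤ) → ℂ} (ha : ExpDecay a) (δ : Fin n → ℝ)
    (l : Fin d) : ExpDecay fun k => Complex.I * (hatFreq δ k l : ℂ) * a k := by
  have h := ExpDecay.sum Finset.univ fun i (_ : i ∈ Finset.univ) =>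
    (ha.freq_mul (i, l)).const_mul ((δ i)⁻¹ : ℝ)
  refine h.of_le 1 fun k => le_of_eq ?_
  rw [one_mul]
  congr 1
  simp only [hatFreq, Complex.ofReal_mul, Complex.ofReal_sum, Finset.mul_sum, Finset.sum_mul]
  refine Finset.sum_congr rfl fun i _ => ?_
  push_cast
  ring

theorem hatD_reFourier {a : (Fin n × Fin d → ℤ) → ℂ} (ha : ExpDecay a) (δ : Fin n → ℝ)
    (l : Fin d) :
    hatD δ l (reFourier a) = reFourier fun k => Complex.I * (hatFreq δ k l : ℂ) * a k := by
  funext y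
  simp only [hatD, coordD_reFourier ha, ← reFourier_real_mul]
  rw [← reFourier_sum Finset.univ fun i _ => (ha.freq_mul (i, l)).const_mul _]
  congr 1
  funext k
  simp only [hatFreq, Complex.ofReal_mul, Complex.ofReal_sum, Finset.mul_sum, Finset.sum_mul]
  refine Finset.sum_congr rfl fun i _ => ?_
  push_cast
  ring

theorem real_mul_reFourier {g : MVar n d → ℝ} {α b : (Fin n × Fin d → ℤ) → ℂ}
    (hα : ExpDecay α) (hb : ExpDecay b) (y : MVar n d) (hg : (g y : ℂ) = fourierSum α y) :
    g y * reFourier b y = reFourier (fourierConv α b) y := by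
  rw [reFourier, reFourier, ← fourierSum_mul hα hb, ← hg, Complex.re_ofReal_mul]

theorem hatLaplacian_reFourier {a : (Fin n × Fin d → ℤ) → ℂ} (ha : ExpDecay a) (δ : Fin n → ℝ)
    (y : MVar n d) :
    hatLaplacian δ (reFourier a) y
      = reFourier (fun k => -((∑ l, hatFreq δ k l ^ 2 : ℝ) : ℂ) * a k) y := by
  simp only [hatLaplacian, hatD_reFourier ha, hatD_reFourier (ha.hatFreq_mul δ _)]
  rw [← reFourier_sum Finset.univ fun l _ => (ha.hatFreq_mul δ l).hatFreq_mul δ l]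
  congr 1
  funext k
  rw [Complex.ofReal_sum, ← Finset.sum_neg_distrib, Finset.sum_mul]
  refine Finset.sum_congr rfl fun l _ => ?_
  push_cast
  linear_combination ((hatFreq δ k l : ℂ) ^ 2 * a k) * Complex.I_sq

theorem torusAverage_reFourier {a : (Fin n × Fin d → ℤ) → ℂ} (ha : ExpDecay a) :
    torusAverage (reFourier a) = (a 0).re := by
  have h := integral_mode_mul_fourierSum ha 0
  simp only [neg_zero, mode_zero, one_mul] at h
  rw [← h, torusAverage]
  exact integral_re (integrableOn_cell (continuous_fourierSum ha)).integrable

end RealPart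

/-! ### Integration by parts for `∇̂` and uniqueness -/

section Uniqueness

variable {n d : ℕ}

theorem contDiff_coordD {f : MVar n d → ℝ} (hf : ContDiff ℝ ∞ f) (p : Fin n × Fin d) :
    ContDiff ℝ ∞ (coordD p f) :=
  (contDiff_infty_iff_fderiv.1 hf).2.clm_apply contDiff_const

theorem contDiff_hatD {f : MVar n d → ℝ} (hf : ContDiff ℝ ∞ f) (δ : Fin n → ℝ) (k : Fin d) :
    ContDiff ℝ ∞ (hatD δ k f) :=
  ContDiff.sum fun i _ => contDiff_const.mul (contDiff_coordD hf (i, k))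

theorem coordD_periodic {f : MVar n d → ℝ} (hf : IsTorusPeriodic f) (p : Fin n × Fin d) :
    IsTorusPeriodic (coordD p f) := by
  intro z y
  have h : (fun x => f (x + fun p => (z p : ℝ))) = f := funext fun x => hf z x
  have h2 := fderiv_comp_add_right (𝕜 := ℝ) (f := f) (x := y) fun p => (z p : ℝ)
  rw [h] at h2
  unfold coordD
  rw [h2]
  rfl

theorem hatD_periodic {f : MVar n d → ℝ} (hf : IsTorusPeriodic f) (δ : Fin n → ℝ) (k : Fin d) :
    IsTorusPeriodic (hatD δ k f) := by
  intro z y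
  unfold hatD
  exact Finset.sum_congr rfl fun i _ => by rw [coordD_periodic hf]

theorem hatD_mul {f g : MVar n d → ℝ} (hf : ContDiff ℝ ∞ f) (hg : ContDiff ℝ ∞ g) (δ : Fin n → ℝ)
    (k : Fin d) (y : MVar n d) :
    hatD δ k (fun z => f z * g z) y = f y * hatD δ k g y + g y * hatD δ k f y := by
  have h1 : ∀ p, coordD p (fun z => f z * g z) y = f y * coordD p g y + g y * coordD p f y := by
    intro p
    have h : HasFDerivAt (fun z => f z * g z) (f y • fderiv ℝ g y + g y • fderiv ℝ f y) y :=
      ((hf.differentiable (by simp)) y).hasFDerivAt.mul ((hg.differentiable (by simp)) y).hasFDerivAt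
    simp only [coordD]
    rw [h.fderiv]
    simp
  simp only [hatD, h1, Finset.mul_sum, ← Finset.sum_add_distrib]
  exact Finset.sum_congr rfl fun i _ => by ring

theorem hatD_sub {f g : MVar n d → ℝ} (hf : ContDiff ℝ ∞ f) (hg : ContDiff ℝ ∞ g) (δ : Fin n → ℝ)
    (k : Fin d) (y : MVar n d) :
    hatD δ k (fun z => f z - g z) y = hatD δ k f y - hatD δ k g y := by
  have h1 : ∀ p, coordD p (fun z => f z - g z) y = coordD p f y - coordD p g y := by
    intro p
    have h : HasFDerivAt (fun z => f z - g z) (fderiv ℝ f y - fderiv ℝ g y) y :=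
      ((hf.differentiable (by simp)) y).hasFDerivAt.sub ((hg.differentiable (by simp)) y).hasFDerivAt
    simp only [coordD]
    rw [h.fderiv]
    rfl
  simp only [hatD, h1, ← Finset.sum_sub_distrib]
  exact Finset.sum_congr rfl fun i _ => by ring

theorem integrableOn_unitCell {f : MVar n d → ℝ} (hf : Continuous f) :
    IntegrableOn f (unitCell n d) :=
  hf.continuousOn.integrableOn_compact isCompact_Icc

theorem integral_hatD_eq_zero {f : MVar n d → ℝ} (hf : ContDiff ℝ ∞ f) (hper : IsTorusPeriodic f)
    (δ : Fin n → ℝ) (k : Fin d) : ∫ y in unitCell n d, hatD δ k f y = 0 := by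
  have h1 : ∀ p, ∫ y in unitCell n d, coordD p f y = 0 := by
    intro p
    have h := realCoeff_fderiv (hf.of_le (by exact_mod_cast le_top)) hper p 0
    rw [realCoeff_zero] at h
    simpa [coordD, unitCell] using h
  simp only [hatD]
  rw [integral_finsetSum _ fun i _ =>
    (integrableOn_unitCell (contDiff_coordD hf (i, k)).continuous).const_mul _]
  simp only [integral_const_mul, h1, mul_zero, Finset.sum_const_zero]

theorem eq_zero_of_integral_sq {f : MVar n d → ℝ} (hf : Continuous f) (hper : IsTorusPeriodic f)
    (h : ∫ y in unitCell n d, f y ^ 2 ≤ 0) (y : MVar n d) : f y = 0 := by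
  have h1 : ∫ y in unitCell n d, f y ^ 2 = 0 := le_antisymm h (integral_nonneg fun _ => sq_nonneg _)
  rw [integral_eq_zero_iff_of_nonneg (fun _ => sq_nonneg _)
    (integrableOn_unitCell (hf.pow 2))] at h1
  have h2 : f =ᵐ[volume.restrict (Set.Icc (0 : MVar n d) 1)] 0 := by
    filter_upwards [h1] with x hx
    exact pow_eq_zero_iff two_ne_zero |>.1 hx
  obtain ⟨z, hz⟩ := exists_shift_mem_cell y
  rw [← hper z y]
  exact eqOn_cell_of_ae_eq hf continuous_zero h2 hz

/-- Correctors are unique, by the energy identity. -/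
theorem IsCorrector.unique {lam C₀ Λ₀ τ : ℝ} {δ : Fin n → ℝ}
    {A : MVar n d → Matrix (Fin d) (Fin d) ℝ} (hlam : 0 < lam)
    (hA : IsAnalyticCoefficient lam C₀ Λ₀ A) (hτ : 0 < τ) {X Y : Fin d → MVar n d → ℝ}
    (hX : IsCorrector δ τ A X) (hY : IsCorrector δ τ A Y) : X = Y := by
  funext j y
  rw [← sub_eq_zero]
  set D : MVar n d → ℝ := fun z => X j z - Y j z with hD
  have hDs : ContDiff ℝ ∞ D := (hX.smooth j).sub (hY.smooth j)
  have hDp : IsTorusPeriodic D := fun z y => by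
    simp only [hD]
    rw [hX.periodic j, hY.periodic j]
  have hAp : ∀ k l, IsTorusPeriodic fun z => A z k l := fun k l z y => by
    simp only [hA.periodic z y]
  have hflux : ∀ {F : MVar n d → ℝ}, ContDiff ℝ ∞ F → ∀ k,
      ContDiff ℝ ∞ fun z => ∑ l, A z k l * hatD δ l F z := fun hF k =>
    ContDiff.sum fun l _ => (hA.smooth k l).mul (contDiff_hatD hF δ l)
  set V : Fin d → MVar n d → ℝ := fun k z => ∑ l, A z k l * hatD δ l D z with hV
  have hVs : ∀ k, ContDiff ℝ ∞ (V k) := fun k => hflux hDs k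
  have hVp : ∀ k, IsTorusPeriodic (V k) := fun k z y => by
    simp only [hV]
    exact Finset.sum_congr rfl fun l _ => congrArg₂ (· * ·) (hAp k l z y) (hatD_periodic hDp δ l z y)
  have hVsub : ∀ k, V k = fun z => (∑ l, A z k l * hatD δ l (X j) z)
      - ∑ l, A z k l * hatD δ l (Y j) z := by
    intro k
    funext z
    simp only [hV, hD, hatD_sub (hX.smooth j) (hY.smooth j), mul_sub, Finset.sum_sub_distrib]
  have heq : ∀ y, -(∑ k, hatD δ k (V k) y) + τ ^ 2 * D y = 0 := by
    intro y
    have h1 := hX.equation j y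
    have h2 := hY.equation j y
    have h3 : ∑ k, hatD δ k (V k) y
        = ∑ k, hatD δ k (fun z => ∑ l, A z k l * hatD δ l (X j) z) y
          - ∑ k, hatD δ k (fun z => ∑ l, A z k l * hatD δ l (Y j) z) y := by
      rw [← Finset.sum_sub_distrib]
      refine Finset.sum_congr rfl fun k _ => ?_
      rw [hVsub k, hatD_sub (hflux (hX.smooth j) k) (hflux (hY.smooth j) k)]
    rw [h3]
    simp only [hD]
    linarith
  have hid : ∀ y, ∑ k, hatD δ k (fun z => D z * V k z) y
      = τ ^ 2 * D y ^ 2 + ∑ k, V k y * hatD δ k D y := by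
    intro y
    simp only [hatD_mul hDs (hVs _), Finset.sum_add_distrib, ← Finset.mul_sum]
    linear_combination (-D y) * heq y
  have hell : ∀ y, 0 ≤ ∑ k, V k y * hatD δ k D y := by
    intro y
    have h1 := hA.elliptic y fun k => hatD δ k D y
    have h2 : (fun k => hatD δ k D y) ⬝ᵥ (A y).mulVec (fun k => hatD δ k D y)
        = ∑ k, V k y * hatD δ k D y := by
      simp only [dotProduct, Matrix.mulVec, hV]
      exact Finset.sum_congr rfl fun k _ => mul_comm _ _
    rw [← h2]
    exact le_trans (by positivity) h1
  have hint : ∫ y in unitCell n d, ∑ k, hatD δ k (fun z => D z * V k z) y = 0 := by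
    rw [integral_finsetSum _ fun k _ =>
      integrableOn_unitCell (contDiff_hatD (hDs.mul (hVs k)) δ k).continuous]
    exact Finset.sum_eq_zero fun k _ => integral_hatD_eq_zero (hDs.mul (hVs k))
      (fun z y => congrArg₂ (· * ·) (hDp z y) (hVp k z y)) δ k
  refine eq_zero_of_integral_sq hDs.continuous hDp ?_ y
  have hmono : ∫ y in unitCell n d, τ ^ 2 * D y ^ 2
      ≤ ∫ y in unitCell n d, ∑ k, hatD δ k (fun z => D z * V k z) y := by
    refine setIntegral_mono
      (integrableOn_unitCell (continuous_const.mul (hDs.continuous.pow 2)))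
      (integrableOn_unitCell (continuous_finsetSum _ fun k _ =>
        (contDiff_hatD (hDs.mul (hVs k)) δ k).continuous)) fun y => ?_
    dsimp only
    rw [hid y]
    linarith [hell y]
  rw [hint, integral_const_mul] at hmono
  exact nonpos_of_mul_nonpos_right hmono (by positivity)

/-- The operator `-Δ̂ + τ²` is symmetric on smooth periodic functions. -/
theorem integral_mul_hatLaplacian {f g : MVar n d → ℝ} (hf : ContDiff ℝ ∞ f) (hg : ContDiff ℝ ∞ g)
    (hfp : IsTorusPeriodic f) (hgp : IsTorusPeriodic g) (δ : Fin n → ℝ) (τ : ℝ) :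
    ∫ y in unitCell n d, f y * (-hatLaplacian δ g y + τ ^ 2 * g y)
      = ∫ y in unitCell n d, (-hatLaplacian δ f y + τ ^ 2 * f y) * g y := by
  set W : Fin d → MVar n d → ℝ := fun k z => g z * hatD δ k f z - f z * hatD δ k g z with hW
  have hWs : ∀ k, ContDiff ℝ ∞ (W k) := fun k =>
    (hg.mul (contDiff_hatD hf δ k)).sub (hf.mul (contDiff_hatD hg δ k))
  have hWp : ∀ k, IsTorusPeriodic (W k) := fun k z y => by
    simp only [hW]
    rw [hfp, hgp, hatD_periodic hfp, hatD_periodic hgp]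
  have hL : ∀ {h : MVar n d → ℝ}, ContDiff ℝ ∞ h →
      Continuous fun y => -hatLaplacian δ h y + τ ^ 2 * h y := fun hh =>
    ((continuous_finsetSum _ fun k _ =>
      (contDiff_hatD (contDiff_hatD hh δ k) δ k).continuous).neg).add
      (continuous_const.mul hh.continuous)
  have hid : ∀ y, f y * (-hatLaplacian δ g y + τ ^ 2 * g y)
      - (-hatLaplacian δ f y + τ ^ 2 * f y) * g y = ∑ k, hatD δ k (W k) y := by
    intro y
    have h1 : ∀ k, hatD δ k (W k) y
        = g y * hatD δ k (hatD δ k f) y - f y * hatD δ k (hatD δ k g) y := by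
      intro k
      simp only [hW]
      rw [hatD_sub (hg.mul (contDiff_hatD hf δ k)) (hf.mul (contDiff_hatD hg δ k)),
        hatD_mul hg (contDiff_hatD hf δ k), hatD_mul hf (contDiff_hatD hg δ k)]
      ring
    simp only [h1, Finset.sum_sub_distrib, ← Finset.mul_sum, hatLaplacian]
    ring
  have hi1 : IntegrableOn (fun y => f y * (-hatLaplacian δ g y + τ ^ 2 * g y)) (unitCell n d) :=
    integrableOn_unitCell (hf.continuous.mul (hL hg))
  have hi2 : IntegrableOn (fun y => (-hatLaplacian δ f y + τ ^ 2 * f y) * g y) (unitCell n d) :=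
    integrableOn_unitCell ((hL hf).mul hg.continuous)
  rw [← sub_eq_zero, ← integral_sub hi1 hi2]
  simp only [hid]
  rw [integral_finsetSum _ fun k _ =>
    integrableOn_unitCell (contDiff_hatD (hWs k) δ k).continuous]
  exact Finset.sum_eq_zero fun k _ => integral_hatD_eq_zero (hWs k) (hWp k) δ k

theorem expDecay_single (k : Fin n × Fin d → ℤ) (c : ℂ) :
    ExpDecay (Pi.single k c : (Fin n × Fin d → ℤ) → ℂ) := by
  refine ⟨1, one_pos, ‖c‖ * Real.exp (modeSize k), fun l => ?_⟩
  by_cases h : l = k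
  · subst h
    rw [Pi.single_eq_same, mul_assoc, ← Real.exp_add]
    simp
  · rw [Pi.single_eq_of_ne h, norm_zero]
    positivity

theorem reFourier_single (k : Fin n × Fin d → ℤ) (c : ℂ) (y : MVar n d) :
    reFourier (Pi.single k c) y = (c * mode k y).re := by
  rw [reFourier, fourierSum, tsum_eq_single k fun l hl => by rw [Pi.single_eq_of_ne hl, zero_mul],
    Pi.single_eq_same]

theorem memLp_unitCell {f : MVar n d → ℝ} (hf : Continuous f) :
    MemLp f 2 (volume.restrict (unitCell n d)) := by
  have h := (memLp_cell_of_continuous (Complex.continuous_ofReal.comp hf)).re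
  exact h

/-- Square integrable weak solutions are unique: the modes are eigenfunctions of `-Δ̂ + τ²` with
positive eigenvalues, so testing with them determines all Fourier coefficients. -/
theorem IsWeakFluxCorrector.ae_eq {τ : ℝ} {δ : Fin n → ℝ}
    {A : MVar n d → Matrix (Fin d) (Fin d) ℝ} (hτ : 0 < τ) {X : Fin d → MVar n d → ℝ}
    {U V : Fin d → Fin d → MVar n d → ℝ} (hU : IsFluxCorrector δ τ A X U)
    (hV : IsWeakFluxCorrector δ τ A X V) (i j : Fin d) :
    V i j =ᵐ[volume.restrict (unitCell n d)] U i j := by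
  have hmem : MemLp (fun y => V i j y - U i j y) 2 (volume.restrict (unitCell n d)) :=
    (hV.memLp i j).sub (memLp_unitCell (hU.smooth i j).continuous)
  have htest : ∀ (k : Fin n × Fin d → ℤ) (c : ℂ),
      ∫ y in unitCell n d, (V i j y - U i j y) * (c * mode k y).re = 0 := by
    intro k c
    set η : MVar n d → ℝ := reFourier (Pi.single k c) with hη
    have hs := expDecay_single k c
    have hηs : ContDiff ℝ ∞ η := contDiff_reFourier hs
    have hηp : IsTorusPeriodic η := reFourier_periodic _
    set μ : ℝ := ∑ l, hatFreq δ k l ^ 2 + τ ^ 2 with hμ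
    have hμ0 : 0 < μ := by
      have : 0 ≤ ∑ l, hatFreq δ k l ^ 2 := Finset.sum_nonneg fun _ _ => sq_nonneg _
      positivity
    have heig : ∀ y, -hatLaplacian δ η y + τ ^ 2 * η y = μ * η y := by
      intro y
      have h1 : (fun l => -((∑ a, hatFreq δ l a ^ 2 : ℝ) : ℂ) * (Pi.single k c : _ → ℂ) l)
          = fun l => ((-∑ a, hatFreq δ k a ^ 2 : ℝ) : ℂ) * (Pi.single k c : _ → ℂ) l := by
        funext l
        by_cases h : l = k
        · subst h
          push_cast
          ring
        · simp [h]
      rw [hη, hatLaplacian_reFourier hs, h1, reFourier_real_mul, hμ]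
      ring
    have h1 := hV.equation i j η hηs hηp
    have h2 := integral_mul_hatLaplacian (hU.smooth i j) hηs (hU.periodic i j) hηp δ τ
    simp only [hU.equation i j] at h2
    rw [← h2] at h1
    simp only [heig] at h1
    have hi1 : IntegrableOn (fun y => V i j y * (μ * η y)) (unitCell n d) :=
      (hV.memLp i j).integrable_mul (memLp_unitCell (continuous_const.mul hηs.continuous))
    have hi2 : IntegrableOn (fun y => U i j y * (μ * η y)) (unitCell n d) :=
      integrableOn_unitCell ((hU.smooth i j).continuous.mul
        (continuous_const.mul hηs.continuous))
    have h3 : ∫ y in unitCell n d, μ * ((V i j y - U i j y) * η y) = 0 := by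
      rw [← sub_eq_zero, ← integral_sub hi1 hi2] at h1
      rw [← h1]
      congr 1
      funext y
      ring
    rw [integral_const_mul, mul_eq_zero] at h3
    have h4 := h3.resolve_left hμ0.ne'
    simpa only [hη, reFourier_single] using h4
  have hW : MemLp (fun y => ((V i j y - U i j y : ℝ) : ℂ)) 2
      (volume.restrict (Set.Icc (0 : MVar n d) 1)) := hmem.ofReal
  have hzero := ae_eq_zero_of_coeff_eq_zero hW fun k => by
    have hi : Integrable (fun y => mode k y * ((V i j y - U i j y : ℝ) : ℂ))
        (volume.restrict (Set.Icc (0 : MVar n d) 1)) :=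
      (memLp_cell_of_continuous (continuous_mode k)).integrable_mul hW
    apply Complex.ext
    · have h1 := integral_re hi
      have h2 := htest k 1
      rw [Complex.zero_re, ← h2]
      refine h1.symm.trans ?_
      refine integral_congr_ae (Filter.Eventually.of_forall fun y => ?_)
      simp [mul_comm]
    · have h1 := integral_im hi
      have h2 := htest k (-Complex.I)
      rw [Complex.zero_im, ← h2]
      refine h1.symm.trans ?_
      refine integral_congr_ae (Filter.Eventually.of_forall fun y => ?_)
      simp [mul_comm]
  filter_upwards [hzero] with y hy
  have : V i j y - U i j y = 0 := by
    simpa using congrArg Complex.re hy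
  linarith

end Uniqueness

/-! ### Construction of the correctors and the flux correctors -/

section Correctors

variable {n d : ℕ}

/-- The Fourier coefficients of the entry `(a, b)` of the coefficient matrix. -/
def matCoeff (A : MVar n d → Matrix (Fin d) (Fin d) ℝ) (a b : Fin d) :
    (Fin n × Fin d → ℤ) → ℂ :=
  realCoeff fun y => A y a b

/-- The Fourier coefficients of the entry `(i, j)` of `A + A ∇̂ X`, when `x j` are the ones of
`X^j`. -/
def fluxCoeff (δ : Fin n → ℝ) (A : MVar n d → Matrix (Fin d) (Fin d) ℝ)
    (x : Fin d → (Fin n × Fin d → ℤ) → ℂ) (i j : Fin d) (k : Fin n × Fin d → ℤ) : ℂ :=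
  matCoeff A i j k
    + ∑ l, fourierConv (matCoeff A i l) (fun k => Complex.I * (hatFreq δ k l : ℂ) * x j k) k

variable {lam C₀ Λ₀ τ : ℝ} {δ : Fin n → ℝ} {A : MVar n d → Matrix (Fin d) (Fin d) ℝ}

theorem IsAnalyticCoefficient.entry_periodic (hA : IsAnalyticCoefficient lam C₀ Λ₀ A)
    (a b : Fin d) : IsTorusPeriodic fun y => A y a b := fun z y => by
  simp only [hA.periodic z y]

theorem IsAnalyticCoefficient.norm_matCoeff_le (hA : IsAnalyticCoefficient lam C₀ Λ₀ A)
    (hΛ : 0 < Λ₀) [Nonempty (Fin n × Fin d)] (a b : Fin d) (k : Fin n × Fin d → ℤ) :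
    ‖matCoeff A a b k‖
      ≤ 2 * C₀ * Real.exp (-(Real.pi / (Λ₀ * Fintype.card (Fin n × Fin d))) * modeSize k) := by
  refine norm_realCoeff_le_exp (hA.smooth a b) (hA.entry_periodic a b) hΛ (fun l y p => ?_) k
  refine le_trans ?_ (hA.analytic l y)
  refine le_trans ?_ (Finset.single_le_sum (f := fun a => ∑ b, ∑ j : Fin l → Fin n × Fin d,
      |iteratedFDeriv ℝ l (fun z => A z a b) y (fun s => Pi.single (j s) 1)|)
    (fun _ _ => Finset.sum_nonneg fun _ _ => Finset.sum_nonneg fun _ _ => abs_nonneg _)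
    (Finset.mem_univ a))
  refine le_trans ?_ (Finset.single_le_sum (f := fun b => ∑ j : Fin l → Fin n × Fin d,
      |iteratedFDeriv ℝ l (fun z => A z a b) y (fun s => Pi.single (j s) 1)|)
    (fun _ _ => Finset.sum_nonneg fun _ _ => abs_nonneg _) (Finset.mem_univ b))
  exact Finset.single_le_sum (f := fun j : Fin l → Fin n × Fin d =>
      |iteratedFDeriv ℝ l (fun z => A z a b) y (fun s => Pi.single (j s) 1)|)
    (fun _ _ => abs_nonneg _) (Finset.mem_univ fun _ => p)

theorem IsAnalyticCoefficient.expDecay_matCoeff (hA : IsAnalyticCoefficient lam C₀ Λ₀ A)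
    (hΛ : 0 < Λ₀) [Nonempty (Fin n × Fin d)] (a b : Fin d) : ExpDecay (matCoeff A a b) :=
  ⟨_, div_pos Real.pi_pos (mul_pos hΛ (by exact_mod_cast Fintype.card_pos)), _,
    hA.norm_matCoeff_le hΛ a b⟩

theorem IsAnalyticCoefficient.eq_fourierSum (hA : IsAnalyticCoefficient lam C₀ Λ₀ A)
    (hΛ : 0 < Λ₀) [Nonempty (Fin n × Fin d)] (a b : Fin d) (y : MVar n d) :
    (A y a b : ℂ) = fourierSum (matCoeff A a b) y :=
  eq_fourierSum_realCoeff (hA.smooth a b).continuous (hA.entry_periodic a b)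
    (hA.expDecay_matCoeff hΛ a b) y

theorem IsAnalyticCoefficient.eq_reFourier (hA : IsAnalyticCoefficient lam C₀ Λ₀ A)
    (hΛ : 0 < Λ₀) [Nonempty (Fin n × Fin d)] (a b : Fin d) :
    (fun y => A y a b) = reFourier (matCoeff A a b) := by
  funext y
  rw [reFourier, ← hA.eq_fourierSum hΛ, Complex.ofReal_re]

theorem IsAnalyticCoefficient.isCoerciveSymbol (hA : IsAnalyticCoefficient lam C₀ Λ₀ A) :
    IsCoerciveSymbol lam (matCoeff A) := by
  refine isCoerciveSymbol_realCoeff (A := fun y a b => A y a b)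
    (fun a b => (hA.smooth a b).continuous) fun y ξ => ?_
  have h := hA.elliptic y ξ
  rw [EuclideanSpace.norm_sq_eq] at h
  simp only [Real.norm_eq_abs, sq_abs] at h
  refine h.trans (le_of_eq ?_)
  simp only [dotProduct, Matrix.mulVec, Finset.mul_sum]
  exact Finset.sum_congr rfl fun a _ => Finset.sum_congr rfl fun b _ => by ring

theorem IsAnalyticCoefficient.mul_grad_eq (hA : IsAnalyticCoefficient lam C₀ Λ₀ A)
    (hΛ : 0 < Λ₀) [Nonempty (Fin n × Fin d)] {u : (Fin n × Fin d → ℤ) → ℂ} (hu : ExpDecay u)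
    (a : Fin d) :
    (fun z => ∑ l, A z a l * hatD δ l (reFourier u) z)
      = reFourier fun k => ∑ l, fourierConv (matCoeff A a l)
          (fun k => Complex.I * (hatFreq δ k l : ℂ) * u k) k := by
  funext z
  rw [reFourier_sum Finset.univ fun l _ => (hA.expDecay_matCoeff hΛ a l).conv (hu.hatFreq_mul δ l)]
  refine Finset.sum_congr rfl fun l _ => ?_
  rw [hatD_reFourier hu]
  exact real_mul_reFourier (g := fun z => A z a l) (hA.expDecay_matCoeff hΛ a l)
    (hu.hatFreq_mul δ l) z (hA.eq_fourierSum hΛ a l z)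

/-- The symbol of `-∇̂ · A ∇̂` acting on coefficients. -/
theorem tsum_symbolEntry {α : Fin d → Fin d → (Fin n × Fin d → ℤ) → ℂ}
    (hα : ∀ a b, ExpDecay (α a b)) {u : (Fin n × Fin d → ℤ) → ℂ} (hu : ExpDecay u)
    (k : Fin n × Fin d → ℤ) :
    ∑' l, symbolEntry α (hatFreq δ) k l * u l
      = -∑ a, Complex.I * (hatFreq δ k a : ℂ) * ∑ b, fourierConv (α a b)
          (fun k => Complex.I * (hatFreq δ k b : ℂ) * u k) k := by
  have hsum : ∀ a b, Summable fun l =>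
      α a b (k - l) * (Complex.I * (hatFreq δ l b : ℂ) * u l) := by
    intro a b
    obtain ⟨ρ, hρ, C, hC⟩ := hα a b
    refine Summable.of_norm_bounded
      (((hu.hatFreq_mul δ b).summable).mul_left |C|) fun l => ?_
    rw [norm_mul]
    refine mul_le_mul_of_nonneg_right ((hC _).trans ?_) (norm_nonneg _)
    calc C * Real.exp (-ρ * modeSize (k - l)) ≤ |C| * 1 := by
          refine mul_le_mul (le_abs_self C) ?_ (Real.exp_pos _).le (abs_nonneg C)
          rw [Real.exp_le_one_iff]
          have := modeSize_nonneg (k - l)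
          nlinarith
      _ = |C| := mul_one _
  have h1 : ∀ l, symbolEntry α (hatFreq δ) k l * u l
      = ∑ a, ∑ b, -(Complex.I * (hatFreq δ k a : ℂ))
        * (α a b (k - l) * (Complex.I * (hatFreq δ l b : ℂ) * u l)) := by
    intro l
    simp only [symbolEntry, Finset.sum_mul]
    refine Finset.sum_congr rfl fun a _ => Finset.sum_congr rfl fun b _ => ?_
    linear_combination ((hatFreq δ k a : ℂ) * α a b (k - l) * (hatFreq δ l b : ℂ) * u l)
      * Complex.I_sq
  simp only [h1]
  have hsum' : ∀ a b, Summable fun l => -(Complex.I * (hatFreq δ k a : ℂ))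
      * (α a b (k - l) * (Complex.I * (hatFreq δ l b : ℂ) * u l)) := fun a b =>
    (hsum a b).mul_left _
  have hsum2 : ∀ a, Summable fun l => ∑ b, -(Complex.I * (hatFreq δ k a : ℂ))
      * (α a b (k - l) * (Complex.I * (hatFreq δ l b : ℂ) * u l)) := fun a =>
    summable_sum fun b _ => hsum' a b
  rw [Summable.tsum_finsetSum fun a _ => hsum2 a, ← Finset.sum_neg_distrib]
  refine Finset.sum_congr rfl fun a _ => ?_
  rw [Summable.tsum_finsetSum fun b _ => hsum' a b, Finset.mul_sum, ← Finset.sum_neg_distrib]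
  refine Finset.sum_congr rfl fun b _ => ?_
  rw [tsum_mul_left, fourierConv, neg_mul]

/-- A family of coefficients solving the equation on the Fourier side yields the correctors. -/
theorem isCorrector_reFourier (hA : IsAnalyticCoefficient lam C₀ Λ₀ A) (hΛ : 0 < Λ₀)
    [Nonempty (Fin n × Fin d)] {x : Fin d → (Fin n × Fin d → ℤ) → ℂ} (hx : ∀ j, ExpDecay (x j))
    (heq : ∀ j k, ∑' l, symbolEntry (matCoeff A) (hatFreq δ) k l * x j l + (τ : ℂ) ^ 2 * x j k
      = Complex.I * ∑ a, (hatFreq δ k a : ℂ) * matCoeff A a j k) :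
    IsCorrector δ τ A fun j => reFourier (x j) := by
  refine ⟨fun j => contDiff_reFourier (hx j), fun j => reFourier_periodic _, fun j y => ?_⟩
  have hα := hA.expDecay_matCoeff hΛ
  have hconv : ∀ a, ExpDecay fun k => ∑ l, fourierConv (matCoeff A a l)
      (fun k => Complex.I * (hatFreq δ k l : ℂ) * x j k) k := fun a =>
    ExpDecay.sum _ fun l _ => (hα a l).conv ((hx j).hatFreq_mul δ l)
  have hdiv : ExpDecay fun k => ∑ a, Complex.I * (hatFreq δ k a : ℂ)
      * ∑ l, fourierConv (matCoeff A a l)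
        (fun k => Complex.I * (hatFreq δ k l : ℂ) * x j k) k :=
    ExpDecay.sum _ fun a _ => (hconv a).hatFreq_mul δ a
  simp only [hA.mul_grad_eq hΛ (hx j), hA.eq_reFourier hΛ, hatD_reFourier (hconv _),
    hatD_reFourier (hα _ _)]
  rw [← reFourier_sum Finset.univ fun a _ => (hconv a).hatFreq_mul δ a,
    ← reFourier_sum Finset.univ fun a _ => (hα a j).hatFreq_mul δ a]
  have h1 : ∀ k, ∑ a, Complex.I * (hatFreq δ k a : ℂ) * matCoeff A a j k
      = ((-1 : ℝ) : ℂ) * (∑ a, Complex.I * (hatFreq δ k a : ℂ) * ∑ l, fourierConv (matCoeff A a l)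
        (fun k => Complex.I * (hatFreq δ k l : ℂ) * x j k) k)
        + ((τ ^ 2 : ℝ) : ℂ) * x j k := by
    intro k
    have h2 := heq j k
    rw [tsum_symbolEntry hα (hx j), Finset.mul_sum] at h2
    simp only [← mul_assoc] at h2 ⊢
    rw [← h2]
    push_cast
    ring
  simp only [h1]
  rw [reFourier_add (hdiv.const_mul _) ((hx j).const_mul _), reFourier_real_mul,
    reFourier_real_mul]
  ring

theorem expDecay_fluxCoeff (hA : IsAnalyticCoefficient lam C₀ Λ₀ A) (hΛ : 0 < Λ₀)
    [Nonempty (Fin n × Fin d)] {x : Fin d → (Fin n × Fin d → ℤ) → ℂ} (hx : ∀ j, ExpDecay (x j))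
    (i j : Fin d) : ExpDecay (fluxCoeff δ A x i j) :=
  (hA.expDecay_matCoeff hΛ i j).add (ExpDecay.sum _ fun l _ =>
    (hA.expDecay_matCoeff hΛ i l).conv ((hx j).hatFreq_mul δ l))

theorem corrFlux_eq_reFourier (hA : IsAnalyticCoefficient lam C₀ Λ₀ A) (hΛ : 0 < Λ₀)
    [Nonempty (Fin n × Fin d)] {x : Fin d → (Fin n × Fin d → ℤ) → ℂ} (hx : ∀ j, ExpDecay (x j))
    (i j : Fin d) :
    corrFlux δ A (fun j => reFourier (x j)) i j = reFourier (fluxCoeff δ A x i j) := by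
  funext y
  have h1 := congrFun (hA.mul_grad_eq (δ := δ) hΛ (hx j) i) y
  have h2 := congrFun (hA.eq_reFourier hΛ i j) y
  rw [corrFlux, h1, h2]
  exact (reFourier_add (hA.expDecay_matCoeff hΛ i j) (ExpDecay.sum _ fun l _ =>
    (hA.expDecay_matCoeff hΛ i l).conv ((hx j).hatFreq_mul δ l)) y).symm

/-- The Fourier coefficients of the flux corrector. -/
def fluxCorrCoeff (δ : Fin n → ℝ) (τ : ℝ) (g : (Fin n × Fin d → ℤ) → ℂ)
    (k : Fin n × Fin d → ℤ) : ℂ :=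
  if k = 0 then 0 else -(((∑ l, hatFreq δ k l ^ 2 + τ ^ 2)⁻¹ : ℝ) : ℂ) * g k

theorem expDecay_fluxCorrCoeff {g : (Fin n × Fin d → ℤ) → ℂ} (hg : ExpDecay g) (hτ : 0 < τ) :
    ExpDecay (fluxCorrCoeff δ τ g) := by
  refine hg.of_le (τ ^ 2)⁻¹ fun k => ?_
  unfold fluxCorrCoeff
  split_ifs
  · rw [norm_zero]; positivity
  · have h0 : 0 ≤ ∑ l, hatFreq δ k l ^ 2 := Finset.sum_nonneg fun _ _ => sq_nonneg _
    rw [norm_mul, norm_neg, Complex.norm_real, Real.norm_of_nonneg (by positivity)]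
    gcongr
    linarith

theorem isFluxCorrector_reFourier (hA : IsAnalyticCoefficient lam C₀ Λ₀ A) (hΛ : 0 < Λ₀)
    [Nonempty (Fin n × Fin d)] (hτ : 0 < τ) {x : Fin d → (Fin n × Fin d → ℤ) → ℂ}
    (hx : ∀ j, ExpDecay (x j)) :
    IsFluxCorrector δ τ A (fun j => reFourier (x j))
      fun i j => reFourier (fluxCorrCoeff δ τ (fluxCoeff δ A x i j)) := by
  have hg := expDecay_fluxCoeff (δ := δ) hA hΛ hx
  have hu := fun i j => expDecay_fluxCorrCoeff (δ := δ) (hg i j) hτ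
  refine ⟨fun i j => contDiff_reFourier (hu i j), fun i j => reFourier_periodic _,
    fun i j y => ?_⟩
  set g := fluxCoeff δ A x i j with hgdef
  have hsrc : fluxSource δ A (fun j => reFourier (x j)) i j y = (g 0).re - reFourier g y := by
    have h1 := congrFun (corrFlux_eq_reFourier (δ := δ) hA hΛ hx i j) y
    rw [corrFlux] at h1
    rw [fluxSource, effMatrix, corrFlux_eq_reFourier hA hΛ hx, torusAverage_reFourier (hg i j),
      hgdef, ← h1]
    ring
  rw [hsrc, hatLaplacian_reFourier (hu i j)]
  have hu2 : ExpDecay fun k => -((∑ l, hatFreq δ k l ^ 2 : ℝ) : ℂ) * fluxCorrCoeff δ τ g k := by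
    refine (hg i j).of_le 1 fun k => ?_
    unfold fluxCorrCoeff
    split_ifs
    · simp
    · have h0 : 0 ≤ ∑ l, hatFreq δ k l ^ 2 := Finset.sum_nonneg fun _ _ => sq_nonneg _
      have hpos : 0 < ∑ l, hatFreq δ k l ^ 2 + τ ^ 2 := by positivity
      rw [norm_mul, norm_neg, Complex.norm_real, norm_mul, norm_neg, Complex.norm_real,
        Real.norm_of_nonneg h0, Real.norm_of_nonneg (inv_nonneg.2 hpos.le), ← mul_assoc]
      refine mul_le_mul_of_nonneg_right ?_ (norm_nonneg _)
      rw [← div_eq_mul_inv, div_le_one hpos]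
      linarith [sq_nonneg τ]
  have h1 : reFourier (Pi.single 0 (g 0)) y = (g 0).re := by
    rw [reFourier_single, mode_zero, mul_one]
  rw [← h1]
  have h2 : (g : (Fin n × Fin d → ℤ) → ℂ)
      = fun k => (((1 : ℝ) : ℂ) * (Pi.single 0 (g 0) : (Fin n × Fin d → ℤ) → ℂ) k
        + ((1 : ℝ) : ℂ) * (-((∑ l, hatFreq δ k l ^ 2 : ℝ) : ℂ) * fluxCorrCoeff δ τ g k))
        + ((-τ ^ 2 : ℝ) : ℂ) * fluxCorrCoeff δ τ g k := by
    funext k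
    by_cases hk : k = 0
    · subst hk
      simp [fluxCorrCoeff]
    · have h0 : 0 ≤ ∑ l, hatFreq δ k l ^ 2 := Finset.sum_nonneg fun _ _ => sq_nonneg _
      have hpos : 0 < ∑ l, hatFreq δ k l ^ 2 + τ ^ 2 := by positivity
      have hne : ((∑ l, hatFreq δ k l ^ 2 + τ ^ 2 : ℝ) : ℂ) ≠ 0 := by exact_mod_cast hpos.ne'
      rw [fluxCorrCoeff, if_neg hk, Pi.single_eq_of_ne hk, Complex.ofReal_inv]
      have h3 : ((-τ ^ 2 : ℝ) : ℂ) = ((∑ l, hatFreq δ k l ^ 2 : ℝ) : ℂ)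
          - ((∑ l, hatFreq δ k l ^ 2 + τ ^ 2 : ℝ) : ℂ) := by
        push_cast
        ring
      rw [h3]
      field_simp
      push_cast
      ring
  have h4 := congrArg (fun a => reFourier a y) h2
  rw [reFourier_add (((expDecay_single 0 (g 0)).const_mul _).add (hu2.const_mul _))
      ((hu i j).const_mul _),
    reFourier_add ((expDecay_single 0 (g 0)).const_mul _) (hu2.const_mul _), reFourier_real_mul,
    reFourier_real_mul, reFourier_real_mul] at h4
  linarith

end Correctors

/-! ### Resonances and the uniform bound -/

section Bounds

/-- The only resonances are at high frequency: if `|κ(k)| < 1` for some `k ≠ 0`, then `|k|`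
dominates the ratio of two consecutive scales. Indeed the last block `i` of `k` that is not zero
must be cancelled by the preceding ones, which carry factors at most `δ_{i-1}⁻¹`. -/
theorem exists_ratio_le_modeSize {m d : ℕ} {ε : Fin (m + 1) → ℝ} (hε : ∀ i, 0 < ε i)
    (hanti : StrictAnti ε) {k : Fin (m + 1) × Fin d → ℤ} (hk : k ≠ 0)
    (hres : ∀ a, |hatFreq (relScale ε) k a| < 1) :
    ∃ i : Fin m, ε i.castSucc / ε i.succ ≤ modeSize k := by
  classical
  obtain ⟨p, hp⟩ := Function.ne_iff.1 hk
  have hne : (Finset.univ.filter fun i : Fin (m + 1) => ∃ a, k (i, a) ≠ 0).Nonempty :=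
    ⟨p.1, by simpa using ⟨p.2, hp⟩⟩
  obtain ⟨i, hi, hmax⟩ := Finset.exists_max_image _ id hne
  obtain ⟨a, ha⟩ : ∃ a, k (i, a) ≠ 0 := by simpa using hi
  have hzero : ∀ j, i < j → k (j, a) = 0 := by
    intro j hj
    by_contra h
    have := hmax j (by simpa using ⟨a, h⟩)
    exact absurd hj (not_lt.2 this)
  have hone : (1 : ℝ) ≤ |(k (i, a) : ℝ)| := by
    exact_mod_cast Int.one_le_abs ha
  set s : Fin (m + 1) → ℝ := fun j => (relScale ε j)⁻¹ with hs
  have hspos : ∀ j, 0 < s j := fun j => inv_pos.2 (div_pos (hε j) (hε 0))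
  have hs0 : s 0 = 1 := by simp [hs, relScale, div_self (hε 0).ne']
  have hsmono : Monotone s := by
    intro j l hjl
    simp only [hs, relScale, inv_div]
    have := hanti.antitone hjl
    have h1 := hε l
    have h2 := hε 0
    gcongr
  have hlt : |∑ j, s j * (k (j, a) : ℝ)| < 1 := by
    have h1 := hres a
    rw [hatFreq, abs_mul, abs_of_pos (by positivity)] at h1
    have h2 : (1 : ℝ) ≤ 2 * Real.pi := by linarith [Real.pi_gt_three]
    have h3 := mul_le_mul_of_nonneg_right h2 (abs_nonneg (∑ j, s j * (k (j, a) : ℝ)))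
    rw [one_mul] at h3
    exact h3.trans_lt h1
  have hsplit : s i * (k (i, a) : ℝ) = ∑ j, s j * (k (j, a) : ℝ)
      - ∑ j ∈ Finset.univ.erase i, s j * (k (j, a) : ℝ) := by
    rw [← Finset.add_sum_erase _ _ (Finset.mem_univ i)]
    ring
  have hsize : |(k (i, a) : ℝ)| + ∑ j ∈ Finset.univ.erase i, |(k (j, a) : ℝ)| ≤ modeSize k := by
    rw [Finset.add_sum_erase _ (fun j => |(k (j, a) : ℝ)|) (Finset.mem_univ i), modeSize,
      Fintype.sum_prod_type]
    exact Finset.sum_le_sum fun j _ => Finset.single_le_sum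
      (f := fun b => |(k (j, b) : ℝ)|) (fun _ _ => abs_nonneg _) (Finset.mem_univ a)
  -- Terms before `i` carry factors at most `q`, terms after `i` vanish.
  have hcancel : ∀ q, 1 ≤ q → (∀ j, j < i → s j ≤ q) → s i ≤ q * modeSize k := by
    intro q hq hj
    have h1 : |∑ j ∈ Finset.univ.erase i, s j * (k (j, a) : ℝ)|
        ≤ q * ∑ j ∈ Finset.univ.erase i, |(k (j, a) : ℝ)| := by
      rw [Finset.mul_sum]
      refine (Finset.abs_sum_le_sum_abs _ _).trans (Finset.sum_le_sum fun j hj' => ?_)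
      rw [abs_mul, abs_of_pos (hspos j)]
      rcases lt_or_gt_of_ne (Finset.ne_of_mem_erase hj') with h | h
      · exact mul_le_mul_of_nonneg_right (hj j h) (abs_nonneg _)
      · simp [hzero j h]
    have h2 : s i ≤ |s i * (k (i, a) : ℝ)| := by
      rw [abs_mul, abs_of_pos (hspos i)]
      exact le_mul_of_one_le_right (hspos i).le hone
    rw [hsplit] at h2
    have h3 := abs_sub (∑ j, s j * (k (j, a) : ℝ))
      (∑ j ∈ Finset.univ.erase i, s j * (k (j, a) : ℝ))
    nlinarith [Finset.sum_nonneg fun j (_ : j ∈ Finset.univ.erase i) => abs_nonneg (k (j, a) : ℝ)]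
  have hi0 : i ≠ 0 := by
    rintro rfl
    have h1 : ∑ j ∈ Finset.univ.erase (0 : Fin (m + 1)), s j * (k (j, a) : ℝ) = 0 :=
      Finset.sum_eq_zero fun j hj => by
        rw [hzero j (Fin.pos_of_ne_zero (Finset.ne_of_mem_erase hj)), Int.cast_zero, mul_zero]
    rw [h1, sub_zero, hs0, one_mul] at hsplit
    rw [← hsplit] at hlt
    linarith
  obtain ⟨j, rfl⟩ := Fin.exists_succ_eq.2 hi0
  refine ⟨j, ?_⟩
  have h1 := hcancel (s j.castSucc) (by rw [← hs0]; exact hsmono (Fin.zero_le _))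
    fun l hl => hsmono (Fin.le_castSucc_iff.2 hl)
  simp only [hs, relScale, inv_div] at h1
  have e1 := hε j.castSucc
  have e2 := hε j.succ
  have e0 := hε 0
  rw [div_le_iff₀ e2] at h1 ⊢
  have h2 : ε 0 * ε j.castSucc ≤ ε 0 * (modeSize k * ε j.succ) := by
    calc ε 0 * ε j.castSucc
        ≤ ε 0 / ε j.castSucc * modeSize k * ε j.succ * ε j.castSucc := by gcongr
      _ = ε 0 * (modeSize k * ε j.succ) := by field_simp
  exact le_of_mul_le_mul_left h2 e0

theorem exp_le_maxExpRatio {m : ℕ} (c : ℝ) (ε : Fin (m + 1) → ℝ) (i : Fin m) :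
    Real.exp (-c * ε i.castSucc / ε i.succ) ≤ maxExpRatio c ε :=
  le_ciSup (f := fun i : Fin m => Real.exp (-c * ε i.castSucc / ε i.succ))
    (Set.finite_range _).bddAbove i

/-- The multiplier `(|κ|² + τ²)⁻¹` of the flux equation is harmless away from resonances, and at
resonances it is compensated by the size of the frequency. -/
theorem inv_multiplier_le {m d : ℕ} {ε : Fin (m + 1) → ℝ} (hε : ∀ i, 0 < ε i)
    (hanti : StrictAnti ε) {c K τ : ℝ} (hc : 0 < c) (hK : 1 ≤ K)
    (hτ : K⁻¹ * maxExpRatio c ε ≤ τ) (hτ0 : 0 < τ) {k : Fin (m + 1) × Fin d → ℤ} (hk : k ≠ 0) :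
    (∑ l, hatFreq (relScale ε) k l ^ 2 + τ ^ 2)⁻¹ ≤ K ^ 2 * Real.exp (2 * c * modeSize k) := by
  have hs := modeSize_nonneg k
  have hsum : 0 ≤ ∑ l, hatFreq (relScale ε) k l ^ 2 := Finset.sum_nonneg fun _ _ => sq_nonneg _
  by_cases hres : ∀ a, |hatFreq (relScale ε) k a| < 1
  · obtain ⟨i, hi⟩ := exists_ratio_le_modeSize hε hanti hk hres
    have h1 : K⁻¹ * Real.exp (-c * modeSize k) ≤ τ := by
      refine le_trans ?_ hτ
      gcongr
      refine le_trans (Real.exp_le_exp.2 ?_) (exp_le_maxExpRatio c ε i)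
      rw [mul_div_assoc]
      exact mul_le_mul_of_nonpos_left hi (by linarith)
    calc (∑ l, hatFreq (relScale ε) k l ^ 2 + τ ^ 2)⁻¹ ≤ (τ ^ 2)⁻¹ := by
          gcongr
          linarith
      _ ≤ ((K⁻¹ * Real.exp (-c * modeSize k)) ^ 2)⁻¹ := by gcongr
      _ = K ^ 2 * Real.exp (2 * c * modeSize k) := by
          rw [mul_pow, mul_inv, inv_pow, inv_inv, ← Real.exp_nat_mul, ← Real.exp_neg]
          congr 2
          push_cast
          ring
  · push Not at hres
    obtain ⟨a, ha⟩ := hres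
    have h1 : 1 ≤ ∑ l, hatFreq (relScale ε) k l ^ 2 := by
      refine le_trans ?_ (Finset.single_le_sum (f := fun l => hatFreq (relScale ε) k l ^ 2)
        (fun _ _ => sq_nonneg _) (Finset.mem_univ a))
      rw [← sq_abs]
      exact one_le_pow₀ ha
    have h2 : (∑ l, hatFreq (relScale ε) k l ^ 2 + τ ^ 2)⁻¹ ≤ 1 :=
      inv_le_one_of_one_le₀ (by linarith [sq_nonneg τ])
    have h3 : 1 ≤ Real.exp (2 * c * modeSize k) := Real.one_le_exp (by positivity)
    have h4 : 1 ≤ K ^ 2 := one_le_pow₀ hK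
    exact h2.trans (one_le_mul_of_one_le_of_one_le h4 h3)

theorem normLinf_reFourier_le {n d : ℕ} {a : (Fin n × Fin d → ℤ) → ℂ} {ρ H : ℝ} (hρ : 0 < ρ)
    (ha : ∀ k, ‖a k‖ ≤ H * Real.exp (-ρ * modeSize k)) :
    normLinf (reFourier a)
      ≤ ENNReal.ofReal (H * ∑' k : Fin n × Fin d → ℤ, Real.exp (-ρ * modeSize k)) := by
  have hdec : ExpDecay a := ⟨ρ, hρ, H, ha⟩
  rw [normLinf, eLpNorm_exponent_top]
  refine eLpNormEssSup_le_of_ae_bound (Filter.Eventually.of_forall fun y => ?_)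
  rw [Real.norm_eq_abs]
  refine (abs_reFourier_le hdec y).trans ?_
  rw [← tsum_mul_left]
  exact hdec.summable.tsum_le_tsum ha ((summable_exp_modeSize hρ).mul_left H)

/-- The uniform bound for the flux corrector with exponentially decaying data. -/
theorem fluxNorm_le {m d : ℕ} {ε : Fin (m + 1) → ℝ} (hε : ∀ i, 0 < ε i)
    (hanti : StrictAnti ε) {ρ K τ G : ℝ} (hρ : 0 < ρ) (hK : 1 ≤ K)
    (hτ : K⁻¹ * maxExpRatio (ρ / 4) ε ≤ τ) (hτ0 : 0 < τ)
    {g : Fin d → Fin d → (Fin (m + 1) × Fin d → ℤ) → ℂ}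
    (hg : ∀ i j k, ‖g i j k‖ ≤ G * Real.exp (-ρ * modeSize k)) :
    fluxNorm (relScale ε) (fun i j => reFourier (fluxCorrCoeff (relScale ε) τ (g i j)))
      ≤ ((d : ℝ≥0∞) ^ 4 + (d : ℝ≥0∞) ^ 3 + (d : ℝ≥0∞) ^ 2) * ENNReal.ofReal (G * (1 + K ^ 2)
        * ∑' k : Fin (m + 1) × Fin d → ℤ, Real.exp (-(ρ / 2) * modeSize k)) := by
  set H := ENNReal.ofReal (G * (1 + K ^ 2)
        * ∑' k : Fin (m + 1) × Fin d → ℤ, Real.exp (-(ρ / 2) * modeSize k))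
  have hu := fun i j => expDecay_fluxCorrCoeff (δ := relScale ε) (⟨ρ, hρ, G, hg i j⟩ :
    ExpDecay (g i j)) hτ0
  -- A multiplier `t` with `t ≤ 1 + |κ|²` leaves at most half of the exponential decay.
  have hmult : ∀ (i j : Fin d) (k : Fin (m + 1) × Fin d → ℤ) (t : ℂ),
      ‖t‖ ≤ 1 + ∑ l, hatFreq (relScale ε) k l ^ 2 →
      ‖t * fluxCorrCoeff (relScale ε) τ (g i j) k‖
        ≤ G * (1 + K ^ 2) * Real.exp (-(ρ / 2) * modeSize k) := by
    intro i j k t ht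
    have hs := modeSize_nonneg k
    have hG : 0 ≤ G := nonneg_of_mul_nonneg_left ((norm_nonneg _).trans (hg i j k))
      (Real.exp_pos _)
    by_cases hk : k = 0
    · rw [fluxCorrCoeff, if_pos hk, mul_zero, norm_zero]
      positivity
    set Q := ∑ l, hatFreq (relScale ε) k l ^ 2 with hQ
    have hQ0 : 0 ≤ Q := Finset.sum_nonneg fun _ _ => sq_nonneg _
    have hpos : 0 < Q + τ ^ 2 := by positivity
    have h1 := inv_multiplier_le hε hanti (by positivity) hK hτ hτ0 hk
    have h2 : 1 ≤ Real.exp (2 * (ρ / 4) * modeSize k) := Real.one_le_exp (by positivity)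
    have h3 : ‖t‖ * (Q + τ ^ 2)⁻¹ ≤ (1 + K ^ 2) * Real.exp (2 * (ρ / 4) * modeSize k) := by
      have h4 : ‖t‖ * (Q + τ ^ 2)⁻¹ ≤ (1 + Q) * (Q + τ ^ 2)⁻¹ := by gcongr
      have h5 : Q * (Q + τ ^ 2)⁻¹ ≤ 1 := by
        rw [← div_eq_mul_inv, div_le_one hpos]
        linarith [sq_nonneg τ]
      linarith
    rw [fluxCorrCoeff, if_neg hk, norm_mul, norm_mul, norm_neg, Complex.norm_real,
      Real.norm_of_nonneg (inv_nonneg.2 hpos.le), ← mul_assoc]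
    calc ‖t‖ * (Q + τ ^ 2)⁻¹ * ‖g i j k‖
        ≤ (1 + K ^ 2) * Real.exp (2 * (ρ / 4) * modeSize k)
          * (G * Real.exp (-ρ * modeSize k)) := by
          gcongr
          exact hg i j k
      _ = G * (1 + K ^ 2)
          * (Real.exp (2 * (ρ / 4) * modeSize k) * Real.exp (-ρ * modeSize k)) := by ring
      _ = _ := by
          rw [← Real.exp_add]
          congr 2
          ring
  have hle : ∀ (k : Fin (m + 1) × Fin d → ℤ) (l : Fin d),
      hatFreq (relScale ε) k l ^ 2 ≤ ∑ l, hatFreq (relScale ε) k l ^ 2 := fun k l =>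
    Finset.single_le_sum (f := fun l => hatFreq (relScale ε) k l ^ 2)
      (fun _ _ => sq_nonneg _) (Finset.mem_univ l)
  have hfreq : ∀ (k : Fin (m + 1) × Fin d → ℤ) (l : Fin d),
      ‖Complex.I * (hatFreq (relScale ε) k l : ℂ)‖ = |hatFreq (relScale ε) k l| := fun k l => by
    rw [norm_mul, Complex.norm_I, one_mul, Complex.norm_real, Real.norm_eq_abs]
  have hb0 : ∀ i j, normLinf (reFourier (fluxCorrCoeff (relScale ε) τ (g i j))) ≤ H := by
    intro i j
    refine normLinf_reFourier_le (by positivity) fun k => ?_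
    have h := hmult i j k 1 (by
      rw [norm_one]
      linarith [Finset.sum_nonneg fun l (_ : l ∈ Finset.univ) =>
        sq_nonneg (hatFreq (relScale ε) k l)])
    rwa [one_mul] at h
  have hb1 : ∀ i j l,
      normLinf (hatD (relScale ε) l (reFourier (fluxCorrCoeff (relScale ε) τ (g i j)))) ≤ H := by
    intro i j l
    rw [hatD_reFourier (hu i j)]
    refine normLinf_reFourier_le (by positivity) fun k => hmult i j k _ ?_
    rw [hfreq]
    have h1 := hle k l
    rw [← sq_abs] at h1
    nlinarith [sq_nonneg (|hatFreq (relScale ε) k l| - 1)]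
  have hb2 : ∀ i j k l, normLinf (hatD (relScale ε) k
      (hatD (relScale ε) l (reFourier (fluxCorrCoeff (relScale ε) τ (g i j))))) ≤ H := by
    intro i j l l'
    rw [hatD_reFourier (hu i j), hatD_reFourier ((hu i j).hatFreq_mul _ _)]
    refine normLinf_reFourier_le (by positivity) fun k => ?_
    rw [← mul_assoc]
    refine hmult i j k _ ?_
    rw [norm_mul, hfreq, hfreq]
    have h1 := hle k l
    have h2 := hle k l'
    rw [← sq_abs] at h1 h2
    nlinarith [sq_nonneg (|hatFreq (relScale ε) k l| - |hatFreq (relScale ε) k l'|)]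
  rw [fluxNorm, add_mul, add_mul]
  refine add_le_add (add_le_add ?_ ?_) ?_
  · calc _ ≤ ∑ _i : Fin d, ∑ _j : Fin d, ∑ _k : Fin d, ∑ _l : Fin d, H :=
          Finset.sum_le_sum fun i _ => Finset.sum_le_sum fun j _ => Finset.sum_le_sum fun k _ =>
            Finset.sum_le_sum fun l _ => hb2 i j k l
      _ = (d : ℝ≥0∞) ^ 4 * H := by
          simp only [Finset.sum_const, Finset.card_univ, Fintype.card_fin, nsmul_eq_mul]
          ring
  · calc _ ≤ ∑ _i : Fin d, ∑ _j : Fin d, ∑ _k : Fin d, H :=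
          Finset.sum_le_sum fun i _ => Finset.sum_le_sum fun j _ => Finset.sum_le_sum fun k _ =>
            hb1 i j k
      _ = (d : ℝ≥0∞) ^ 3 * H := by
          simp only [Finset.sum_const, Finset.card_univ, Fintype.card_fin, nsmul_eq_mul]
          ring
  · calc _ ≤ ∑ _i : Fin d, ∑ _j : Fin d, H :=
          Finset.sum_le_sum fun i _ => Finset.sum_le_sum fun j _ => hb0 i j
      _ = (d : ℝ≥0∞) ^ 2 * H := by
          simp only [Finset.sum_const, Finset.card_univ, Fintype.card_fin, nsmul_eq_mul]
          ring

end Bounds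

/-! ### Existence and the uniform estimate -/

section Existence

variable {n d : ℕ} {lam C₀ Λ₀ : ℝ} {A : MVar n d → Matrix (Fin d) (Fin d) ℝ}

/-- Correctors exist, and their flux has Fourier coefficients with exponential decay uniform in `τ`
and in the scales. -/
theorem exists_corrector {σ θ τ : ℝ} {δ : Fin n → ℝ} (hlam : 0 < lam) (hC₀ : 0 < C₀)
    (hΛ : 0 < Λ₀) [Nonempty (Fin n × Fin d)] (hA : IsAnalyticCoefficient lam C₀ Λ₀ A)
    (hσ : 2 * σ = Real.pi / (Λ₀ * Fintype.card (Fin n × Fin d))) (hσ0 : 0 < σ)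
    (hθ0 : 0 < θ) (hθ1 : θ ≤ 1)
    (hθ : θ * (d * (2 * C₀) * ∑' m : Fin n × Fin d → ℤ, Real.exp (-σ * modeSize m)) ≤ lam / 2)
    (hτ : 0 < τ) :
    ∃ x : Fin d → (Fin n × Fin d → ℤ) → ℂ, (∀ j, ExpDecay (x j)) ∧
      IsCorrector δ τ A (fun j => reFourier (x j)) ∧
      ∀ i j k, ‖fluxCoeff δ A x i j k‖
        ≤ (2 * C₀ + d * (2 * C₀ * (2 * Real.sqrt (d * (2 * C₀) ^ 2
            * ∑' m : Fin n × Fin d → ℤ, Real.exp (-σ * modeSize m)) / lam)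
          * ∑' m : Fin n × Fin d → ℤ, Real.exp (-(θ * σ) * modeSize m)))
          * Real.exp (-(θ * σ) * modeSize k) := by
  set T := ∑' m : Fin n × Fin d → ℤ, Real.exp (-σ * modeSize m) with hT
  set B := d * (2 * C₀) ^ 2 * T with hB
  have hα : ∀ a b m, ‖matCoeff A a b m‖ ≤ 2 * C₀ * Real.exp (-(2 * σ) * modeSize m) := by
    rw [hσ]
    exact hA.norm_matCoeff_le hΛ
  have hBsum : ∀ (j : Fin d) (S : Finset (Fin n × Fin d → ℤ)),
      ∑ k ∈ S, ∑ a, (Real.exp (θ * σ * modeSize k) * ‖matCoeff A a j k‖) ^ 2 ≤ B := by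
    intro j S
    have h1 : ∀ k a, (Real.exp (θ * σ * modeSize k) * ‖matCoeff A a j k‖) ^ 2
        ≤ (2 * C₀) ^ 2 * Real.exp (-σ * modeSize k) := by
      intro k a
      have hs := modeSize_nonneg k
      have h2 : Real.exp (θ * σ * modeSize k) * ‖matCoeff A a j k‖
          ≤ 2 * C₀ * Real.exp (-σ * modeSize k) := by
        calc _ ≤ Real.exp (1 * σ * modeSize k)
              * (2 * C₀ * Real.exp (-(2 * σ) * modeSize k)) := by
              gcongr
              exact hα a j k
          _ = 2 * C₀ * (Real.exp (1 * σ * modeSize k) * Real.exp (-(2 * σ) * modeSize k)) := by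
              ring
          _ = _ := by
              rw [← Real.exp_add]
              congr 2
              ring
      have h3 : Real.exp (-σ * modeSize k) ≤ 1 := by
        rw [Real.exp_le_one_iff]
        nlinarith
      calc _ ≤ (2 * C₀ * Real.exp (-σ * modeSize k)) ^ 2 := by gcongr
        _ = (2 * C₀) ^ 2 * (Real.exp (-σ * modeSize k) * Real.exp (-σ * modeSize k)) := by ring
        _ ≤ (2 * C₀) ^ 2 * (Real.exp (-σ * modeSize k) * 1) := by gcongr
        _ = _ := by rw [mul_one]
    calc _ ≤ ∑ k ∈ S, ∑ _a : Fin d, (2 * C₀) ^ 2 * Real.exp (-σ * modeSize k) :=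
          Finset.sum_le_sum fun k _ => Finset.sum_le_sum fun a _ => h1 k a
      _ = d * (2 * C₀) ^ 2 * ∑ k ∈ S, Real.exp (-σ * modeSize k) := by
          simp only [Finset.sum_const, Finset.card_univ, Fintype.card_fin, nsmul_eq_mul,
            Finset.mul_sum, mul_assoc]
      _ ≤ B := by
          rw [hB]
          gcongr
          exact (summable_exp_modeSize hσ0).sum_le_tsum _ fun _ _ => (Real.exp_pos _).le
  have hρ0 : 0 < θ * σ := mul_pos hθ0 hσ0
  choose x hx1 hx2 hx3 using fun j => exists_solution hlam hA.isCoerciveSymbol (by positivity) hσ0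
    hα hθ0 hθ1 (by rw [Fintype.card_fin]; exact hθ) hτ (hatFreq δ)
    (fun k a => matCoeff A a j k) (hBsum j)
  have hdec : ∀ j, ExpDecay (x j) := fun j => ⟨θ * σ, hρ0, _, hx1 j⟩
  refine ⟨x, hdec, isCorrector_reFourier hA hΛ hdec hx3, fun i j k => ?_⟩
  have hs : ∀ k : Fin n × Fin d → ℤ,
      Real.exp (-(2 * σ) * modeSize k) ≤ Real.exp (-(2 * (θ * σ)) * modeSize k) := fun k => by
    have := modeSize_nonneg k
    have h1 : θ * σ ≤ σ := mul_le_of_le_one_left hσ0.le hθ1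
    gcongr
  have hα1 : ∀ a b k, ‖matCoeff A a b k‖ ≤ 2 * C₀ * Real.exp (-(2 * (θ * σ)) * modeSize k) :=
    fun a b k => (hα a b k).trans (by gcongr 2 * C₀ * ?_; exact hs k)
  have hα2 : ‖matCoeff A i j k‖ ≤ 2 * C₀ * Real.exp (-(θ * σ) * modeSize k) :=
    (hα1 i j k).trans (by
      gcongr 2 * C₀ * ?_
      exact Real.exp_le_exp.2 (by nlinarith [modeSize_nonneg k]))
  rw [fluxCoeff, add_mul]
  refine (norm_add_le _ _).trans (add_le_add hα2 ?_)
  refine (norm_sum_le_of_le _ fun l _ => norm_fourierConv_le hρ0 (hα1 i l)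
    (Cb := 2 * Real.sqrt B / lam) (fun k => ?_) k).trans (le_of_eq ?_)
  · rw [norm_mul, norm_mul, Complex.norm_I, one_mul, Complex.norm_real, Real.norm_eq_abs]
    exact hx2 j k l
  · simp only [Finset.sum_const, Finset.card_univ, Fintype.card_fin, nsmul_eq_mul]
    ring

end Existence

end

/-- There are `n = m + 1 ≥ 2` scales `ε 0 > ε 1 > … > ε m`. -/
theorem theorem4p6 (d m : ℕ) (hd : 1 ≤ d) (hm : 1 ≤ m) (C₀ Λ₀ : ℝ) (hC₀ : 0 < C₀) (hΛ₀ : 0 < Λ₀) :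
    ∃ Ct : ℝ, 0 < Ct ∧ ∀ lam : ℝ, 0 < lam → ∃ c : ℝ, 0 < c ∧ ∀ K : ℝ, 1 ≤ K → ∃ C : ℝ, 0 < C ∧
      ∀ A : MVar (m + 1) d → Matrix (Fin d) (Fin d) ℝ, IsAnalyticCoefficient lam C₀ Λ₀ A →
      ∀ ε : Fin (m + 1) → ℝ, (∀ i, 0 < ε i ∧ ε i ≤ 1) → StrictAnti ε →
        (∀ i : Fin m, ε i.succ ≤ Ct⁻¹ * ε i.castSucc) →
      ∀ τ : ℝ, K⁻¹ * maxExpRatio c ε ≤ τ → τ ≤ K * maxExpRatio c ε →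
        (∃! X : Fin d → MVar (m + 1) d → ℝ, IsCorrector (relScale ε) τ A X) ∧
        ∀ X : Fin d → MVar (m + 1) d → ℝ, IsCorrector (relScale ε) τ A X →
          ∃ U : Fin d → Fin d → MVar (m + 1) d → ℝ,
            IsFluxCorrector (relScale ε) τ A X U ∧
            (∀ V : Fin d → Fin d → MVar (m + 1) d → ℝ,
              IsWeakFluxCorrector (relScale ε) τ A X V →
                ∀ i j, V i j =ᵐ[volume.restrict (unitCell (m + 1) d)] U i j) ∧
            fluxNorm (relScale ε) U ≤ ENNReal.ofReal C := by
  have : Nonempty (Fin (m + 1) × Fin d) := ⟨(0, ⟨0, hd⟩)⟩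
  -- No separation of the scales beyond their strict order is needed, so `Ct = 1` suffices.
  refine ⟨1, one_pos, fun lam hlam => ?_⟩
  set N : ℝ := ((Fintype.card (Fin (m + 1) × Fin d) : ℕ) : ℝ) with hN
  have hN0 : 0 < N := by
    rw [hN]
    exact_mod_cast Fintype.card_pos
  set σ : ℝ := Real.pi / (Λ₀ * N) / 2 with hσdef
  have hσ0 : 0 < σ := by
    have := Real.pi_pos
    positivity
  have hσ : 2 * σ = Real.pi / (Λ₀ * N) := by
    rw [hσdef]
    ring
  set T := ∑' k : Fin (m + 1) × Fin d → ℤ, Real.exp (-σ * modeSize k) with hT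
  have hT0 : 0 ≤ T := tsum_nonneg fun _ => (Real.exp_pos _).le
  -- The weight `θ` is so small that the commutator consumes at most half of the ellipticity.
  set P : ℝ := d * (2 * C₀) * T with hP
  have hP0 : 0 ≤ P := by positivity
  set θ : ℝ := min 1 (lam / 2 / (P + 1)) with hθdef
  have hθ0 : 0 < θ := lt_min one_pos (by positivity)
  have hθ1 : θ ≤ 1 := min_le_left _ _
  have hθ : θ * P ≤ lam / 2 := by
    calc θ * P ≤ lam / 2 / (P + 1) * (P + 1) := by
          gcongr
          · exact min_le_right _ _
          · linarith
      _ = lam / 2 := by field_simp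
  have hρ0 : 0 < θ * σ := mul_pos hθ0 hσ0
  refine ⟨θ * σ / 4, by positivity, fun K hK => ?_⟩
  set G : ℝ := 2 * C₀ + d * (2 * C₀ * (2 * Real.sqrt (d * (2 * C₀) ^ 2 * T) / lam)
    * ∑' k : Fin (m + 1) × Fin d → ℤ, Real.exp (-(θ * σ) * modeSize k)) with hG
  set H : ℝ := G * (1 + K ^ 2)
    * ∑' k : Fin (m + 1) × Fin d → ℤ, Real.exp (-(θ * σ / 2) * modeSize k) with hH
  have hH0 : 0 ≤ H := by
    have h1 : 0 ≤ ∑' k : Fin (m + 1) × Fin d → ℤ, Real.exp (-(θ * σ) * modeSize k) :=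
      tsum_nonneg fun _ => (Real.exp_pos _).le
    have h2 : 0 ≤ ∑' k : Fin (m + 1) × Fin d → ℤ, Real.exp (-(θ * σ / 2) * modeSize k) :=
      tsum_nonneg fun _ => (Real.exp_pos _).le
    positivity
  refine ⟨((d : ℝ) ^ 4 + (d : ℝ) ^ 3 + (d : ℝ) ^ 2) * H + 1, by positivity, ?_⟩
  intro A hA ε hε hanti _ τ hτ _
  have hε0 : ∀ i, 0 < ε i := fun i => (hε i).1
  have hτ0 : 0 < τ := by
    refine lt_of_lt_of_le ?_ hτ
    have h1 := exp_le_maxExpRatio (θ * σ / 4) ε ⟨0, hm⟩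
    have h2 := (Real.exp_pos _).trans_le h1
    have h3 : 0 < K := by linarith
    positivity
  obtain ⟨x, hdec, hX, hflux⟩ := exists_corrector (δ := relScale ε) hlam hC₀ hΛ₀ hA hσ hσ0 hθ0
    hθ1 hθ hτ0
  refine ⟨⟨_, hX, fun Y hY => hY.unique hlam hA hτ0 hX⟩, fun Y hY => ?_⟩
  obtain rfl := hY.unique hlam hA hτ0 hX
  have hU := isFluxCorrector_reFourier (δ := relScale ε) hA hΛ₀ hτ0 hdec
  refine ⟨_, hU, fun V hV i j => IsWeakFluxCorrector.ae_eq hτ0 hU hV i j, ?_⟩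
  refine (fluxNorm_le hε0 hanti hρ0 hK hτ hτ0 hflux).trans ?_
  have hcast : (d : ℝ≥0∞) ^ 4 + (d : ℝ≥0∞) ^ 3 + (d : ℝ≥0∞) ^ 2
      = ENNReal.ofReal ((d : ℝ) ^ 4 + (d : ℝ) ^ 3 + (d : ℝ) ^ 2) := by
    rw [ENNReal.ofReal_add (by positivity) (by positivity),
      ENNReal.ofReal_add (by positivity) (by positivity),
      ENNReal.ofReal_pow (by positivity), ENNReal.ofReal_pow (by positivity),
      ENNReal.ofReal_pow (by positivity), ENNReal.ofReal_natCast]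
  rw [hcast, ← ENNReal.ofReal_mul (by positivity)]
  exact ENNReal.ofReal_le_ofReal (by linarith)
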